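/- Let $H$ be a fixed finite undirected graph, possibly with loops, in which every reflexive clique (a set of pairwise adjacent vertices, each of which has a loop) has at most $2$ vertices, and let $\alpha,\beta,\gamma>0$ be constants. An instance consists of $n$ objects $v_1,\dots,v_n\subseteq\mathbb{R}^2$ and of lists $L(v_i)\subseteq V(H)$; the question ($\textsc{LHom}(H)$) is whether the intersection graph $G$ of the objects (whose vertices are the objects, two distinct ones being adjacent iff they intersect) admits a map $f:V(G)\to V(H)$ with $f(v_i)\in L(v_i)$ for all $i$ and $f(u)f(v)\in E(H)$ for all $uv\in E(G)$. Assume that the objects are - fat: $r_{\mathrm{in}}(v_i)/r_{\mathrm{out}}(v_i)\ge\alpha$ for all $i$, where $r_{\mathrm{in}}(v)$ and $r_{\mathrm{out}}(v)$ are the radii of a largest inscribed and of a smallest circumscribed disk of $v$; - similarly-sized: $\mathrm{diam}(v_i)/\mathrm{diam}(v_j)\le\beta$ for all $i,j$. Assume that the geometric representation is given, in the sense that the algorithm may query, at unit cost, whether two objects intersect, whether a vertex of $H$ is on the list of an object, and, for every object $v_i$, the coordinates of the center and the radius of some disk inscribed in $v_i$ whose radius is at least $\gamma\, r_{\mathrm{in}}(v_i)$.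 Then $\textsc{LHom}(H)$ can be solved in time $2^{\mathcal{O}(n^{2/3}\log n)}$: there are an algorithm (a program of a unit-cost random access machine with natural and real memory whose only arithmetic operations are addition and subtraction, and whose tests compare numbers or query the input), and a constant $C$, both depending only on $H,\alpha,\beta,\gamma$, such that for every $n$ and every such instance with $n$ objects the algorithm halts with the correct answer after at most $C\cdot 2^{C n^{2/3}\log_2 n}$ steps. -/

import Mathlib

noncomputable section

namespace FatLHom

/-! ### Target graphs, intersection graphs, list homomorphisms -/

/-- An undirected graph without multiple edges in which loops are allowed. -/
structure LoopGraph (V : Type*) where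
  Adj : V → V → Prop
  symm : ∀ a b, Adj a b → Adj b a

/-- A reflexive clique: pairwise adjacent vertices, each of which has a loop. -/
def LoopGraph.IsReflexiveClique {V : Type*} (H : LoopGraph V) (s : Finset V) : Prop :=
  ∀ a ∈ s, ∀ b ∈ s, H.Adj a b

open Classical in
/-- The size of a maximum reflexive clique. -/
def LoopGraph.mrc {V : Type*} [Fintype V] (H : LoopGraph V) : ℕ :=
  ((Finset.univ : Finset (Finset V)).filter H.IsReflexiveClique).sup Finset.card

/-- The Euclidean plane. -/
abbrev Plane : Type := EuclideanSpace ℝ (Fin 2)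

/-- The intersection graph of a family of objects in the plane. -/
def intersectionGraph {ι : Type*} (obj : ι → Set Plane) : SimpleGraph ι where
  Adj i j := i ≠ j ∧ (obj i ∩ obj j).Nonempty
  symm := ⟨fun _ _ h => ⟨h.1.symm, by rw [Set.inter_comm]; exact h.2⟩⟩
  loopless := ⟨fun _ h => h.1 rfl⟩

/-- `f` is a homomorphism from `G` to `H` that respects the lists `L`. -/
def IsListHom {ι V : Type*} (G : SimpleGraph ι) (H : LoopGraph V) (L : ι → Set V)
    (f : ι → V) : Prop :=
  (∀ u v, G.Adj u v → H.Adj (f u) (f v)) ∧ ∀ v, f v ∈ L v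

/-! ### Fat, similarly-sized objects -/

/-- The radius of a largest disk inscribed in `s`. For bounded `s` with nonempty interior the
supremum is finite, positive and attained. -/
def inRadius (s : Set Plane) : ℝ :=
  sSup {r : ℝ | ∃ c : Plane, Metric.ball c r ⊆ s}

/-- The radius of a smallest disk circumscribed about `s`; the default value is `0` when `s` is
unbounded. -/
def outRadius (s : Set Plane) : ℝ :=
  sInf {r : ℝ | 0 ≤ r ∧ ∃ c : Plane, s ⊆ Metric.closedBall c r}

/-- Fatness with constant `α`. For `0 < α` it forces every object to be bounded and to have
positive in- and circumradius, since the quotient is `0` otherwise. -/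
def Fat {ι : Type*} (α : ℝ) (obj : ι → Set Plane) : Prop :=
  ∀ i, α ≤ inRadius (obj i) / outRadius (obj i)

/-- The quotient of the largest and the smallest diameter is at most `β`. -/
def SimilarlySized {ι : Type*} (β : ℝ) (obj : ι → Set Plane) : Prop :=
  ∀ i j, Metric.diam (obj i) / Metric.diam (obj j) ≤ β

/-! ### Inputs -/

/-- An input with `n` objects in the plane, a list of colours from `{0, …, k - 1}` for every
object, and for every object a disk (meant to be inscribed in it). -/
structure Input (k n : ℕ) where
  obj : Fin n → Set Plane
  list : Fin n → Set (Fin k)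
  center : Fin n → Plane
  radius : Fin n → ℝ

/-- The disks of the input lie in their objects, and their radii are at least `γ` times the radii
of largest inscribed disks (`γ = 1`: they are largest inscribed disks). -/
def Input.InscribedDisks {k n : ℕ} (I : Input k n) (γ : ℝ) : Prop :=
  ∀ i, Metric.ball (I.center i) (I.radius i) ⊆ I.obj i ∧ γ * inRadius (I.obj i) ≤ I.radius i

/-- The intersection graph of the objects, with the given lists, has a list homomorphism
to `H`. -/
def Input.IsYes {k n : ℕ} (H : LoopGraph (Fin k)) (I : Input k n) : Prop :=
  ∃ f : Fin n → Fin k, IsListHom (intersectionGraph I.obj) H I.list f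

/-! ### The machine model

A random access machine with integer and real memory. Both memories are organised in arrays (the
name of an array is a literal of the program, the index is computed). The only arithmetic is
addition and subtraction (truncated on natural numbers), and reals can influence the computation
only through comparisons. The input is accessed by queries: the number of objects, whether two
objects intersect, whether a colour is on the list of an object, and the centre and radius of the
disk of an object. Every assignment and every test takes one time unit. -/

/-- Expressions for natural numbers. -/
inductive NExp
  | lit (m : ℕ)
  | numObjects
  | get (A : ℕ) (i : NExp)
  | add (e₁ e₂ : NExp)
  | sub (e₁ e₂ : NExp)

/-- Expressions for real numbers. -/
inductive RExp
  | lit (m : ℤ)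
  | get (A : ℕ) (i : NExp)
  | centerX (v : NExp)
  | centerY (v : NExp)
  | radius (v : NExp)
  | add (e₁ e₂ : RExp)
  | sub (e₁ e₂ : RExp)

/-- Tests. -/
inductive Test
  | natLt (e₁ e₂ : NExp)
  | realLt (e₁ e₂ : RExp)
  | intersect (u v : NExp)
  | onList (v a : NExp)
  | neg (b : Test)
  | and (b₁ b₂ : Test)

/-- Programs. -/
inductive Prog
  | setNat (A : ℕ) (i e : NExp)
  | setReal (A : ℕ) (i : NExp) (e : RExp)
  | seq (p q : Prog)
  | ite (b : Test) (p q : Prog)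
  | loop (b : Test) (p : Prog)

/-- The contents of the memory: the value of a cell is indexed by array name and position. -/
structure Memory where
  nat : ℕ → ℕ → ℕ
  real : ℕ → ℕ → ℝ

/-- The memory at the start of a computation. -/
def Memory.init : Memory := ⟨fun _ _ => 0, fun _ _ => 0⟩

/-- Write a natural number. -/
def Memory.setNat (s : Memory) (A i x : ℕ) : Memory :=
  { s with nat := Function.update s.nat A (Function.update (s.nat A) i x) }

/-- Write a real number. -/
def Memory.setReal (s : Memory) (A i : ℕ) (x : ℝ) : Memory :=
  { s with real := Function.update s.real A (Function.update (s.real A) i x) }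

section Semantics

variable {k n : ℕ} (I : Input k n) (s : Memory)

/-- The value of an expression for a natural number. -/
def NExp.val (n : ℕ) (s : Memory) : NExp → ℕ
  | lit m => m
  | numObjects => n
  | get A i => s.nat A (i.val n s)
  | add e₁ e₂ => e₁.val n s + e₂.val n s
  | sub e₁ e₂ => e₁.val n s - e₂.val n s

/-- The value of an expression for a real number; queries about objects that do not exist
return `0`. -/
def RExp.val : RExp → ℝ
  | lit m => m
  | get A i => s.real A (i.val n s)
  | centerX v => if h : v.val n s < n then I.center ⟨v.val n s, h⟩ 0 else 0
  | centerY v => if h : v.val n s < n then I.center ⟨v.val n s, h⟩ 1 else 0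
  | radius v => if h : v.val n s < n then I.radius ⟨v.val n s, h⟩ else 0
  | add e₁ e₂ => RExp.val e₁ + RExp.val e₂
  | sub e₁ e₂ => RExp.val e₁ - RExp.val e₂

/-- When a test succeeds; queries about objects or colours that do not exist fail. -/
def Test.Holds : Test → Prop
  | natLt e₁ e₂ => e₁.val n s < e₂.val n s
  | realLt e₁ e₂ => e₁.val I s < e₂.val I s
  | intersect u v => ∃ (hu : u.val n s < n) (hv : v.val n s < n),
      (I.obj ⟨u.val n s, hu⟩ ∩ I.obj ⟨v.val n s, hv⟩).Nonempty
  | onList v a => ∃ (hv : v.val n s < n) (ha : a.val n s < k),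
      (⟨a.val n s, ha⟩ : Fin k) ∈ I.list ⟨v.val n s, hv⟩
  | neg b => ¬ Test.Holds b
  | and b₁ b₂ => Test.Holds b₁ ∧ Test.Holds b₂

end Semantics

/-- `Exec I p s s' t`: on input `I`, the program `p`, started with memory `s`, halts after exactly
`t` time units with memory `s'`. -/
inductive Exec {k n : ℕ} (I : Input k n) : Prog → Memory → Memory → ℕ → Prop
  | setNat (A : ℕ) (i e : NExp) (s : Memory) :
      Exec I (.setNat A i e) s (s.setNat A (i.val n s) (e.val n s)) 1
  | setReal (A : ℕ) (i : NExp) (e : RExp) (s : Memory) :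
      Exec I (.setReal A i e) s (s.setReal A (i.val n s) (e.val I s)) 1
  | seq {p q : Prog} {s s' s'' : Memory} {t t' : ℕ} :
      Exec I p s s' t → Exec I q s' s'' t' → Exec I (.seq p q) s s'' (t + t')
  | ite_true {b : Test} {p q : Prog} {s s' : Memory} {t : ℕ} :
      b.Holds I s → Exec I p s s' t → Exec I (.ite b p q) s s' (1 + t)
  | ite_false {b : Test} {p q : Prog} {s s' : Memory} {t : ℕ} :
      ¬ b.Holds I s → Exec I q s s' t → Exec I (.ite b p q) s s' (1 + t)
  | loop_true {b : Test} {p : Prog} {s s' s'' : Memory} {t t' : ℕ} :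
      b.Holds I s → Exec I p s s' t → Exec I (.loop b p) s' s'' t' →
      Exec I (.loop b p) s s'' (1 + t + t')
  | loop_false {b : Test} {p : Prog} {s : Memory} :
      ¬ b.Holds I s → Exec I (.loop b p) s s 1

open Classical in
/-- On input `I` the program halts within `T` time units, and then the cell `0` of the integer
array `0` holds `1` or `0` according to whether `I` is a yes-instance or not. -/
def Prog.Solves {k n : ℕ} (P : Prog) (H : LoopGraph (Fin k)) (I : Input k n) (T : ℝ) : Prop :=
  ∃ (out : Memory) (t : ℕ), Exec I P Memory.init out t ∧ (t : ℝ) ≤ T ∧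
    out.nat 0 0 = if I.IsYes H then 1 else 0

end FatLHom

end

noncomputable section

namespace FatLHom

section

/-! ### Subexponential bounds -/

/-! Let `ρ` be the least radius of the given disks, and put a grid of side `ρ / 2` on the plane.
Objects whose centres share a cell contain each other's centres. Objects containing a common point
pairwise meet, so their colours are pairwise adjacent: within a cell a loopless colour occurs at
most once, and the looped colours form a reflexive clique, hence number at most two. Fatness and
similar size force objects that meet into cells whose indices differ by at most a constant `D`.

Let `m` be the cube root of `n`, rounded up. Group the columns into strips of width `D` and take out
the strips of one residue class modulo `m`; do the same with the rows. By averaging, suitable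
classes contain at most `2 * m ^ 2` objects together, and the others fall into blocks of `(D * m) ^
2` cells without intersections between different blocks. Three sets of pairs (object, colour), each
of size `O(m ^ 2)`, are guessed: `E` colours the separator; for each piece that remains, `F` colours
the objects with loopless colours, and `G` tags one representative object per cell with the looped
colours used by the objects close to it. Every other object of the piece then has at most two
colours left, and path consistency solves what remains in polynomial time
(`exists_solution_of_pathConsistent`). There are `2 ^ O(m ^ 2 * log n)` guesses.

The algorithm never sees the grid. It tries all guesses and verifies that they leave at most two
colours, so soundness is a gluing argument free of geometry (`exists_colouring_of_accepts`); the
grid serves only to show that a successful guess exists (`exists_cells`, `accepts_of_colouring`).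

On the machine side, `Dec` is a class of predicates with subexponential decision programs. It is
closed under Boolean operations, bounded quantifiers (`Dec.ex`, `Dec.all`), least fixpoints
(`Dec.fix`) and quantification over guesses (`Dec.search`), so writing the acceptance condition in
this language yields the program. -/

theorem exists_le_cube (n : ℕ) : ∃ m, n ≤ m ^ 3 := ⟨n, Nat.le_self_pow (by norm_num) n⟩

open Classical in
/-- The cube root, rounded up. -/
def cubeRoot (n : ℕ) : ℕ := Nat.find (exists_le_cube n)

theorem le_cubeRoot (n : ℕ) : n ≤ cubeRoot n ^ 3 := by
  classical
  exact Nat.find_spec (exists_le_cube n)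

theorem cubeRoot_le {n m : ℕ} (h : n ≤ m ^ 3) : cubeRoot n ≤ m := by
  classical
  exact Nat.find_min' (exists_le_cube n) h

/-- Functions bounded by `2 ^ O(n ^ (2 / 3) * log n)`. -/
def Subexp (t : ℕ → ℕ) : Prop := ∃ c, ∀ n, t n ≤ (n + 2) ^ (c * (cubeRoot n ^ 2 + 1))

namespace Subexp

theorem mono {t t' : ℕ → ℕ} (h : Subexp t) (h' : ∀ n, t' n ≤ t n) : Subexp t' :=
  let ⟨c, hc⟩ := h
  ⟨c, fun n => (h' n).trans (hc n)⟩

theorem const (c : ℕ) : Subexp fun _ => c := by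
  refine ⟨c, fun n => ?_⟩
  calc c ≤ 2 ^ c := Nat.lt_two_pow_self.le
    _ ≤ (n + 2) ^ c := Nat.pow_le_pow_left (by omega) _
    _ ≤ _ := Nat.pow_le_pow_right (by omega) (Nat.le_mul_of_pos_right _ (by positivity))

theorem id : Subexp fun n => n := by
  refine ⟨1, fun n => ?_⟩
  calc n ≤ n + 2 := by omega
    _ ≤ _ := Nat.le_self_pow (by positivity) _

theorem mul {t t' : ℕ → ℕ} (h : Subexp t) (h' : Subexp t') : Subexp fun n => t n * t' n := by
  obtain ⟨c, hc⟩ := h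
  obtain ⟨c', hc'⟩ := h'
  refine ⟨c + c', fun n => ?_⟩
  rw [add_mul, pow_add]
  exact Nat.mul_le_mul (hc n) (hc' n)

/-- Sums reduce to products by `t + t' ≤ (t + 1) * (t' + 1)`. The summand `1` is absorbed by one
more unit of `c`: the base `n + 2` is at least `2` and the exponent at least `1`, even for `n = 0`.
-/
theorem add {t t' : ℕ → ℕ} (h : Subexp t) (h' : Subexp t') : Subexp fun n => t n + t' n := by
  have := mul (add_one h) (add_one h')
  refine this.mono fun n => ?_
  nlinarith [Nat.zero_le (t n * t' n)]
where
  add_one {t : ℕ → ℕ} (h : Subexp t) : Subexp fun n => t n + 1 := by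
    obtain ⟨c, hc⟩ := h
    refine ⟨c + 1, fun n => ?_⟩
    have h1 : 1 ≤ (n + 2) ^ (c * (cubeRoot n ^ 2 + 1)) := Nat.one_le_pow _ _ (by omega)
    have h2 : 2 ≤ (n + 2) ^ (1 * (cubeRoot n ^ 2 + 1)) :=
      le_trans (by omega) (Nat.le_self_pow (by positivity) (n + 2))
    rw [add_mul, pow_add]
    nlinarith [hc n]

theorem cubeRoot_sq : Subexp fun n => cubeRoot n ^ 2 := by
  have : ∀ n, cubeRoot n ≤ n := fun n => cubeRoot_le (Nat.le_self_pow (by norm_num) n)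
  exact (id.mul id).mono fun n => by nlinarith [this n]

/-- This counts the guesses: words with `c * cubeRoot n ^ 2` letters over an alphabet of `k * n`
nodes and one blank. -/
theorem pow_cubeRoot (k c : ℕ) : Subexp fun n => (k * n + 1) ^ (c * cubeRoot n ^ 2) := by
  refine ⟨(k + 1) * c, fun n => ?_⟩
  have h : k * n + 1 ≤ (n + 2) ^ (k + 1) := by
    have h1 : k + 1 ≤ 2 ^ k := Nat.lt_two_pow_self
    have h2 : 2 ^ k ≤ (n + 2) ^ k := Nat.pow_le_pow_left (by omega) _
    rw [pow_succ]
    nlinarith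
  calc (k * n + 1) ^ (c * cubeRoot n ^ 2) ≤ ((n + 2) ^ (k + 1)) ^ (c * cubeRoot n ^ 2) :=
        Nat.pow_le_pow_left h _
    _ = (n + 2) ^ ((k + 1) * (c * cubeRoot n ^ 2)) := (pow_mul _ _ _).symm
    _ ≤ _ := Nat.pow_le_pow_right (by omega) (by rw [mul_assoc]; gcongr; omega)

end Subexp

/-! ### Total correctness with time bounds -/

@[simp] theorem Memory.setNat_nat (s : Memory) (A i x : ℕ) :
    (s.setNat A i x).nat = Function.update s.nat A (Function.update (s.nat A) i x) := rfl

/-- On input `I` and memory `s` the program halts within `t` time units, with a memory that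
satisfies `post`. -/
def Runs {k n : ℕ} (I : Input k n) (p : Prog) (s : Memory) (t : ℕ) (post : Memory → Prop) :
    Prop :=
  ∃ s' τ, Exec I p s s' τ ∧ τ ≤ t ∧ post s'

namespace Runs

variable {k n : ℕ} {I : Input k n}

theorem mono {p : Prog} {s : Memory} {t t' : ℕ} {post post' : Memory → Prop}
    (h : Runs I p s t post) (ht : t ≤ t') (hp : ∀ s', post s' → post' s') :
    Runs I p s t' post' :=
  let ⟨s', τ, h1, h2, h3⟩ := h
  ⟨s', τ, h1, h2.trans ht, hp _ h3⟩

theorem setNat {A : ℕ} {i e : NExp} {s : Memory} {post : Memory → Prop}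
    (h : post (s.setNat A (i.val n s) (e.val n s))) : Runs I (.setNat A i e) s 1 post :=
  ⟨_, _, .setNat A i e s, le_rfl, h⟩

theorem seq {p q : Prog} {s : Memory} {t t' : ℕ} {post : Memory → Prop}
    (h : Runs I p s t fun s' => Runs I q s' t' post) : Runs I (.seq p q) s (t + t') post :=
  let ⟨_, _, h1, h2, s'', _, h3, h4, h5⟩ := h
  ⟨s'', _, .seq h1 h3, by omega, h5⟩

theorem ite {b : Test} {p q : Prog} {s : Memory} {t : ℕ} {post : Memory → Prop}
    (hp : b.Holds I s → Runs I p s t post) (hq : ¬ b.Holds I s → Runs I q s t post) :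
    Runs I (.ite b p q) s (1 + t) post := by
  by_cases hb : b.Holds I s
  · obtain ⟨s', τ, h1, h2, h3⟩ := hp hb
    exact ⟨s', _, .ite_true hb h1, by omega, h3⟩
  · obtain ⟨s', τ, h1, h2, h3⟩ := hq hb
    exact ⟨s', _, .ite_false hb h1, by omega, h3⟩

/-- The index of the invariant is a variant: it decreases in every round and so bounds the number of
rounds. -/
theorem loop {b : Test} {p : Prog} {t : ℕ} (Inv : ℕ → Memory → Prop)
    (step : ∀ i s, Inv i s → b.Holds I s → Runs I p s t fun s' => ∃ j < i, Inv j s') (i : ℕ)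
    {s : Memory} (hs : Inv i s) :
    Runs I (.loop b p) s (i * (t + 1) + 1) fun s' => (∃ j, Inv j s') ∧ ¬ b.Holds I s' := by
  induction i using Nat.strong_induction_on generalizing s with
  | _ i ih =>
    by_cases hb : b.Holds I s
    · obtain ⟨s', τ, h1, h2, j, hj, h3⟩ := step i s hs hb
      obtain ⟨s'', τ', h4, h5, h6⟩ := ih j hj h3
      refine ⟨s'', _, .loop_true hb h1 h4, ?_, h6⟩
      have : (j + 1) * (t + 1) ≤ i * (t + 1) := Nat.mul_le_mul_right _ hj
      nlinarith
    · exact ⟨s, 1, .loop_false hb, by omega, ⟨i, hs⟩, hb⟩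

end Runs

/-! ### Decidable predicates -/

/-- The number of slots of a guess. -/
def slots (C n : ℕ) : ℕ := C * cubeRoot n ^ 2

/-- The constants that the program keeps in memory: the number of slots, the number of pairs of
nodes, and a table of multiples of the number of nodes. -/
structure Base (k C n : ℕ) (g : ℕ → ℕ → ℕ) : Prop where
  slots : g 1 0 = slots C n
  pairs : g 1 1 = (k * n) * (k * n)
  table : ∀ x < k * n, g 2 x = x * (k * n)

/-- The memories agree on the scalars below `d` and on the arrays below `a`. Array `0` holds the
result of a computation, array `1` the scalars. -/
def Agree (d a : ℕ) (g g' : ℕ → ℕ → ℕ) : Prop :=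
  (∀ i < d, g 1 i = g' 1 i) ∧ ∀ A, 2 ≤ A → A < a → g A = g' A

/-- Set a scalar. -/
def setScalar (g : ℕ → ℕ → ℕ) (d x : ℕ) : ℕ → ℕ → ℕ :=
  Function.update g 1 (Function.update (g 1) d x)

theorem setScalar_one (g : ℕ → ℕ → ℕ) (d x : ℕ) : setScalar g d x 1 d = x := by
  simp [setScalar]

theorem setScalar_one_ne (g : ℕ → ℕ → ℕ) {d i : ℕ} (x : ℕ) (h : i ≠ d) :
    setScalar g d x 1 i = g 1 i := by
  simp [setScalar, h]

theorem setScalar_of_ne (g : ℕ → ℕ → ℕ) (d x : ℕ) {A : ℕ} (h : A ≠ 1) :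
    setScalar g d x A = g A := by
  simp [setScalar, h]

namespace Agree

variable {d a : ℕ} {g g' g'' : ℕ → ℕ → ℕ}

theorem refl (d a : ℕ) (g : ℕ → ℕ → ℕ) : Agree d a g g := ⟨fun _ _ => rfl, fun _ _ _ => rfl⟩

theorem symm (h : Agree d a g g') : Agree d a g' g :=
  ⟨fun i hi => (h.1 i hi).symm, fun A h1 h2 => (h.2 A h1 h2).symm⟩

theorem trans (h : Agree d a g g') (h' : Agree d a g' g'') : Agree d a g g'' :=
  ⟨fun i hi => (h.1 i hi).trans (h'.1 i hi), fun A h1 h2 => (h.2 A h1 h2).trans (h'.2 A h1 h2)⟩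

theorem mono {d' a' : ℕ} (h : Agree d a g g') (hd : d' ≤ d) (ha : a' ≤ a) : Agree d' a' g g' :=
  ⟨fun i hi => h.1 i (by omega), fun A h1 h2 => h.2 A h1 (by omega)⟩

theorem base {k C n : ℕ} (h : Agree d a g g') (hd : 2 ≤ d) (ha : 3 ≤ a) (hg : Base k C n g) :
    Base k C n g' :=
  ⟨(h.1 0 (by omega)) ▸ hg.slots, (h.1 1 (by omega)) ▸ hg.pairs,
    fun x hx => (h.2 2 le_rfl (by omega)) ▸ hg.table x hx⟩

theorem setScalar (h : Agree d a g g') (x : ℕ) :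
    Agree (d + 1) a (setScalar g d x) (setScalar g' d x) := by
  refine ⟨fun i hi => ?_, fun A h1 h2 => ?_⟩
  · rcases eq_or_ne i d with rfl | h'
    · rw [setScalar_one, setScalar_one]
    · rw [setScalar_one_ne _ _ h', setScalar_one_ne _ _ h']; exact h.1 i (by omega)
  · rw [setScalar_of_ne _ _ _ (by omega), setScalar_of_ne _ _ _ (by omega)]; exact h.2 A h1 h2

theorem update (h : Agree d a g g') (ha : 2 ≤ a) (X : ℕ → ℕ) :
    Agree d (a + 1) (Function.update g a X) (Function.update g' a X) := by
  refine ⟨fun i hi => ?_, fun A h1 h2 => ?_⟩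
  · rw [Function.update_of_ne (by omega), Function.update_of_ne (by omega)]; exact h.1 i hi
  · rcases eq_or_ne A a with rfl | h'
    · simp
    · rw [Function.update_of_ne h', Function.update_of_ne h']; exact h.2 A h1 (by omega)

/-- Writing a free scalar. -/
theorem write_scalar (h : Agree d a g g') {i : ℕ} (hi : d ≤ i) (x : ℕ) :
    Agree d a g (Function.update g' 1 (Function.update (g' 1) i x)) := by
  refine ⟨fun j hj => ?_, fun A h1 h2 => ?_⟩
  · rw [Function.update_self, Function.update_of_ne (by omega)]; exact h.1 j hj
  · rw [Function.update_of_ne (by omega)]; exact h.2 A h1 h2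

/-- Writing a free array. -/
theorem write_array (h : Agree d a g g') (ha : 3 ≤ a) {A : ℕ} (hA : a ≤ A) (X : ℕ → ℕ) :
    Agree d a g (Function.update g' A X) := by
  refine ⟨fun j hj => ?_, fun B h1 h2 => ?_⟩
  · rw [Function.update_of_ne (by omega)]; exact h.1 j hj
  · rw [Function.update_of_ne (by omega)]; exact h.2 B h1 h2

/-- Writing the result. -/
theorem write_result (h : Agree d a g g') (X : ℕ → ℕ) :
    Agree d a g (Function.update g' 0 X) := by
  refine ⟨fun j hj => ?_, fun B h1 h2 => ?_⟩
  · rw [Function.update_of_ne (by omega)]; exact h.1 j hj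
  · rw [Function.update_of_ne (by omega)]; exact h.2 B h1 h2

end Agree

open Classical in
/-- The truth value of a proposition. -/
def ind (p : Prop) : ℕ := if p then 1 else 0

theorem ind_true {p : Prop} (h : p) : ind p = 1 := if_pos h

theorem ind_false {p : Prop} (h : ¬ p) : ind p = 0 := if_neg h

theorem ind_pos {p : Prop} : 0 < ind p ↔ p := by
  by_cases h : p <;> simp [ind, h]

theorem ind_lt_one {p : Prop} : ind p < 1 ↔ ¬ p := by
  by_cases h : p <;> simp [ind, h]

/-- A function of the memory that is the value of an expression. -/
structure IsTerm (k C d a : ℕ) (f : ℕ → (ℕ → ℕ → ℕ) → ℕ) : Prop where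
  congr : ∀ n g g', Agree d a g g' → f n g = f n g'
  eval : ∃ e : NExp, ∀ n s, Base k C n s.nat → e.val n s = f n s.nat

namespace IsTerm

variable {k C d a : ℕ} {f f' : ℕ → (ℕ → ℕ → ℕ) → ℕ}

theorem mono {d' a' : ℕ} (h : IsTerm k C d a f) (hd : d ≤ d') (ha : a ≤ a') :
    IsTerm k C d' a' f :=
  ⟨fun n g g' hg => h.congr n g g' (hg.mono hd ha), h.eval⟩

theorem lit (m : ℕ) : IsTerm k C d a fun _ _ => m :=
  ⟨fun _ _ _ _ => rfl, .lit m, fun _ _ _ => rfl⟩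

theorem objects : IsTerm k C d a fun n _ => n :=
  ⟨fun _ _ _ _ => rfl, .numObjects, fun _ _ _ => rfl⟩

theorem scalar {i : ℕ} (hi : i < d) : IsTerm k C d a fun _ g => g 1 i :=
  ⟨fun _ _ _ h => h.1 i hi, .get 1 (.lit i), fun _ _ _ => rfl⟩

theorem get {A : ℕ} (hA : 2 ≤ A) (hAa : A < a) (h : IsTerm k C d a f) :
    IsTerm k C d a fun n g => g A (f n g) := by
  obtain ⟨hc, e, he⟩ := h
  refine ⟨fun n g g' hg => ?_, .get A e, fun n s hs => ?_⟩
  · simp only [hc n g g' hg, hg.2 A hA hAa]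
  · simp [NExp.val, he n s hs]

theorem add (h : IsTerm k C d a f) (h' : IsTerm k C d a f') :
    IsTerm k C d a fun n g => f n g + f' n g := by
  obtain ⟨hc, e, he⟩ := h
  obtain ⟨hc', e', he'⟩ := h'
  refine ⟨fun n g g' hg => ?_, .add e e', fun n s hs => ?_⟩
  · simp only [hc n g g' hg, hc' n g g' hg]
  · simp [NExp.val, he n s hs, he' n s hs]

/-- The machine cannot multiply, but `c` is fixed with the program, so the product unrolls into `c`
additions. -/
theorem smul (c : ℕ) (h : IsTerm k C d a f) : IsTerm k C d a fun n g => c * f n g := by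
  induction c with
  | zero => simpa using lit (k := k) (C := C) (d := d) (a := a) 0
  | succ c ih => simpa [add_mul] using ih.add h

theorem setScalar (h : IsTerm k C d a f) (n : ℕ) (g : ℕ → ℕ → ℕ) (x : ℕ) :
    f n (setScalar g d x) = f n g :=
  h.congr _ _ _ ((Agree.refl d a g).write_scalar le_rfl x).symm

end IsTerm

/-- Bounds of quantifiers. -/
structure IsBound (k C : ℕ) (b : ℕ → ℕ) : Prop where
  subexp : Subexp b
  eval : ∃ e : NExp, ∀ n s, Base k C n s.nat → e.val n s = b n

namespace IsBound

variable {k C : ℕ}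

theorem objects : IsBound k C fun n => n := ⟨.id, .numObjects, fun _ _ _ => rfl⟩

theorem lit (m : ℕ) : IsBound k C fun _ => m := ⟨.const m, .lit m, fun _ _ _ => rfl⟩

theorem slots : IsBound k C (slots C) :=
  ⟨(Subexp.const C).mul .cubeRoot_sq, .get 1 (.lit 0), fun _ _ h => h.slots⟩

theorem pairs : IsBound k C fun n => (k * n) * (k * n) :=
  ⟨((Subexp.const k).mul .id).mul ((Subexp.const k).mul .id), .get 1 (.lit 1),
    fun _ _ h => h.pairs⟩

end IsBound

/-- The predicate `φ` depends only on the input, the scalars below `d` and the arrays below `a`,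
and is decided within a subexponential time bound by a program that does not change them and puts
the truth value in the cell `0` of array `0`. -/
structure Dec (k C d a : ℕ) (φ : ∀ n, Input k n → (ℕ → ℕ → ℕ) → Prop) : Prop where
  two_le : 2 ≤ d
  three_le : 3 ≤ a
  congr : ∀ n I g g', Agree d a g g' → (φ n I g ↔ φ n I g')
  run : ∃ (p : Prog) (t : ℕ → ℕ), Subexp t ∧ ∀ n (I : Input k n) (s : Memory), Base k C n s.nat →
    Runs I p s (t n) fun s' => Agree d a s.nat s'.nat ∧ s'.nat 0 0 = ind (φ n I s.nat)

namespace Dec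

variable {k C d a : ℕ} {φ ψ : ∀ n, Input k n → (ℕ → ℕ → ℕ) → Prop}

theorem iff (h : Dec k C d a φ) (h' : ∀ n I g, ψ n I g ↔ φ n I g) : Dec k C d a ψ := by
  have : ψ = φ := by funext n I g; exact propext (h' n I g)
  rwa [this]

theorem of_test (hd : 2 ≤ d) (ha : 3 ≤ a)
    (hc : ∀ n I g g', Agree d a g g' → (φ n I g ↔ φ n I g')) (b : Test)
    (hb : ∀ n (I : Input k n) s, Base k C n s.nat → (b.Holds I s ↔ φ n I s.nat)) :
    Dec k C d a φ := by
  refine ⟨hd, ha, hc, .ite b (.setNat 0 (.lit 0) (.lit 1)) (.setNat 0 (.lit 0) (.lit 0)),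
    fun _ => 2, .const 2, fun n I s hs => Runs.ite (t := 1) (fun h => ?_) fun h => ?_⟩
  · exact Runs.setNat ⟨(Agree.refl _ _ _).write_result _, by
      simp [NExp.val, ind_true ((hb n I s hs).1 h)]⟩
  · exact Runs.setNat ⟨(Agree.refl _ _ _).write_result _, by
      simp [NExp.val, ind_false (fun h' => h ((hb n I s hs).2 h'))]⟩

/-- The truth value is built into the program, which is legitimate because `P` depends neither on
`n` nor on the input. In this way the adjacencies of `H` become part of the program. -/
theorem const (hd : 2 ≤ d) (ha : 3 ≤ a) (P : Prop) : Dec k C d a fun _ _ _ => P := by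
  by_cases h : P
  · exact of_test hd ha (fun _ _ _ _ _ => Iff.rfl) (.natLt (.lit 0) (.lit 1)) fun n I s _ => by
      simp [Test.Holds, NExp.val, h]
  · exact of_test hd ha (fun _ _ _ _ _ => Iff.rfl) (.natLt (.lit 0) (.lit 0)) fun n I s _ => by
      simp [Test.Holds, NExp.val, h]

theorem lt (hd : 2 ≤ d) (ha : 3 ≤ a) {f f' : ℕ → (ℕ → ℕ → ℕ) → ℕ} (h : IsTerm k C d a f)
    (h' : IsTerm k C d a f') : Dec k C d a fun n _ g => f n g < f' n g := by
  obtain ⟨e, he⟩ := h.eval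
  obtain ⟨e', he'⟩ := h'.eval
  exact of_test hd ha (fun n _ g g' hg => by rw [h.congr n g g' hg, h'.congr n g g' hg])
    (.natLt e e') fun n I s hs => by simp [Test.Holds, he n s hs, he' n s hs]

theorem not (h : Dec k C d a φ) : Dec k C d a fun n I g => ¬ φ n I g := by
  obtain ⟨hd, ha, hc, p, t, ht, hp⟩ := h
  refine ⟨hd, ha, fun n I g g' hg => not_congr (hc n I g g' hg),
    .seq p (.setNat 0 (.lit 0) (.sub (.lit 1) (.get 0 (.lit 0)))), _, ht.add (.const 1),
    fun n I s hs => Runs.seq ((hp n I s hs).mono le_rfl fun s' h' => Runs.setNat ?_)⟩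
  refine ⟨h'.1.write_result _, ?_⟩
  by_cases hφ : φ n I s.nat <;> simp [NExp.val, h'.2, ind, hφ]

/-- The second program starts in the memory left by the first one. This memory agrees with the
original on all that the second predicate can see, so the congruence property transfers the answer.
-/
theorem and (h : Dec k C d a φ) (h' : Dec k C d a ψ) :
    Dec k C d a fun n I g => φ n I g ∧ ψ n I g := by
  obtain ⟨hd, ha, hc, p, t, ht, hp⟩ := h
  obtain ⟨-, -, hc', p', t', ht', hp'⟩ := h'
  refine ⟨hd, ha, fun n I g g' hg => and_congr (hc n I g g' hg) (hc' n I g g' hg),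
    .seq p (.ite (.natLt (.lit 0) (.get 0 (.lit 0))) p' (.setNat 0 (.lit 0) (.lit 0))), _,
    ht.add ((Subexp.const 1).add (ht'.add (.const 1))),
    fun n I s hs => Runs.seq ((hp n I s hs).mono le_rfl fun s' h' =>
      Runs.ite (fun hb => ?_) fun hb => ?_)⟩
  · simp only [Test.Holds, NExp.val, h'.2, ind_pos] at hb
    refine (hp' n I s' (h'.1.base hd ha hs)).mono (by omega) fun s'' h'' => ⟨h'.1.trans h''.1, ?_⟩
    rw [h''.2]
    exact congrArg ind (propext ⟨fun h => ⟨hb, (hc' n I _ _ h'.1).2 h⟩,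
      fun h => (hc' n I _ _ h'.1).1 h.2⟩)
  · simp only [Test.Holds, NExp.val, h'.2, ind_pos] at hb
    refine (Runs.setNat ?_).mono (show 1 ≤ _ by omega) fun _ h => h
    exact ⟨h'.1.write_result _, by simp [NExp.val, ind, hb]⟩

theorem or (h : Dec k C d a φ) (h' : Dec k C d a ψ) :
    Dec k C d a fun n I g => φ n I g ∨ ψ n I g :=
  (h.not.and h'.not).not.iff fun n I g => by tauto

theorem imp (h : Dec k C d a φ) (h' : Dec k C d a ψ) :
    Dec k C d a fun n I g => φ n I g → ψ n I g :=
  (h.not.or h').iff fun n I g => by tauto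

theorem eq (hd : 2 ≤ d) (ha : 3 ≤ a) {f f' : ℕ → (ℕ → ℕ → ℕ) → ℕ} (h : IsTerm k C d a f)
    (h' : IsTerm k C d a f') : Dec k C d a fun n _ g => f n g = f' n g :=
  ((lt hd ha h h').not.and (lt hd ha h' h).not).iff fun n I g => by omega

theorem ne (hd : 2 ≤ d) (ha : 3 ≤ a) {f f' : ℕ → (ℕ → ℕ → ℕ) → ℕ} (h : IsTerm k C d a f)
    (h' : IsTerm k C d a f') : Dec k C d a fun n _ g => f n g ≠ f' n g :=
  (eq hd ha h h').not

theorem exists_mem_list {ι : Type*} (hd : 2 ≤ d) (ha : 3 ≤ a)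
    {φ : ι → ∀ n, Input k n → (ℕ → ℕ → ℕ) → Prop} (h : ∀ x, Dec k C d a (φ x)) (l : List ι) :
    Dec k C d a fun n I g => ∃ x ∈ l, φ x n I g := by
  induction l with
  | nil => exact (const hd ha False).iff fun n I g => by simp
  | cons x l ih => exact ((h x).or ih).iff fun n I g => by simp

/-- Linear search for a witness, which is left in the scalar `d`. -/
theorem find {φ : ∀ n, Input k n → (ℕ → ℕ → ℕ) → ℕ → Prop} {b : ℕ → ℕ} (hd : 2 ≤ d)
    (hb : IsBound k C b) (h : Dec k C (d + 1) a fun n I g => φ n I g (g 1 d))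
    (hφ : ∀ n I g i j, φ n I (setScalar g d i) j ↔ φ n I g j) :
    ∃ (p : Prog) (t : ℕ → ℕ), Subexp t ∧ ∀ n (I : Input k n) (s : Memory), Base k C n s.nat →
    Runs I p s (t n) fun s' => Agree d a s.nat s'.nat ∧
      ((s'.nat 0 0 = 0 ∧ ∀ i < b n, ¬ φ n I s.nat i) ∨
        (s'.nat 0 0 = 1 ∧ s'.nat 1 d < b n ∧ φ n I s.nat (s'.nat 1 d))) := by
  obtain ⟨-, ha, hc, p, t, ht, hp⟩ := h
  obtain ⟨hbs, e, he⟩ := hb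
  have hφc : ∀ n I g g' i, Agree d a g g' → (φ n I g i ↔ φ n I g' i) := fun n I g g' i hg => by
    have := hc n I _ _ (hg.setScalar i)
    rwa [setScalar_one, setScalar_one, hφ, hφ] at this
  refine ⟨.seq (.setNat 0 (.lit 0) (.lit 0)) (.seq (.setNat 1 (.lit d) (.lit 0))
    (.loop (.and (.natLt (.get 0 (.lit 0)) (.lit 1)) (.natLt (.get 1 (.lit d)) e))
      (.seq p (.ite (.natLt (.get 0 (.lit 0)) (.lit 1))
        (.setNat 1 (.lit d) (.add (.get 1 (.lit d)) (.lit 1)))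
        (.setNat 0 (.lit 0) (.lit 1)))))), _,
    (Subexp.const 1).add ((Subexp.const 1).add ((hbs.mul ((ht.add (.const 2)).add
      (.const 1))).add (.const 1))), fun n I s hs => ?_⟩
  -- The variant counts the candidates not yet refuted, and drops to `0` when a witness is found.
  let Inv : ℕ → Memory → Prop := fun i s' => Agree d a s.nat s'.nat ∧
    ((s'.nat 0 0 = 0 ∧ s'.nat 1 d ≤ b n ∧ i = b n - s'.nat 1 d ∧
      ∀ j < s'.nat 1 d, ¬ φ n I s.nat j) ∨
    (s'.nat 0 0 = 1 ∧ i = 0 ∧ s'.nat 1 d < b n ∧ φ n I s.nat (s'.nat 1 d)))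
  refine Runs.seq (Runs.setNat (Runs.seq (Runs.setNat ((Runs.loop (t := t n + 2) Inv ?_ (b n)
      ?_).mono
    le_rfl ?_))))
  · rintro i s' ⟨h1, h2⟩ hb
    have hs' := h1.base hd ha hs
    simp only [Test.Holds, NExp.val, he n s' hs'] at hb
    rcases h2 with ⟨h0, hle, hi, hall⟩ | ⟨h0, -⟩
    swap
    · omega
    refine Runs.seq (t := t n) (t' := 2) ((hp n I s' hs').mono le_rfl ?_)
    rintro s'' ⟨h3, h4⟩
    have h3' := h1.trans (h3.mono (Nat.le_succ d) le_rfl)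
    have hd' : s'.nat 1 d = s''.nat 1 d := h3.1 d (Nat.lt_succ_self d)
    rw [hφc n I _ _ _ h1.symm, hd'] at h4
    refine Runs.ite (t := 1) (fun hb' => Runs.setNat ?_) fun hb' => Runs.setNat ?_
    · simp only [Test.Holds, NExp.val, h4, ind_lt_one] at hb'
      refine ⟨b n - (s''.nat 1 d + 1), by omega, h3'.write_scalar le_rfl _, Or.inl ?_⟩
      simp only [NExp.val, Memory.setNat_nat, Function.update_self]
      refine ⟨by simp [h4, ind, hb'], by omega, trivial, fun j hj => ?_⟩
      rcases Nat.lt_succ_iff_lt_or_eq.1 hj with hj | rfl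
      · exact hall j (by omega)
      · exact hb'
    · simp only [Test.Holds, NExp.val, h4, ind_lt_one, not_not] at hb'
      refine ⟨0, by omega, h3'.write_result _, Or.inr ?_⟩
      simp only [NExp.val, Memory.setNat_nat, Function.update_self]
      refine ⟨trivial, trivial, ?_⟩
      simp only [ne_eq, one_ne_zero, not_false_eq_true, Function.update_of_ne]
      exact ⟨by omega, hb'⟩
  · refine ⟨((Agree.refl _ _ _).write_result _).write_scalar le_rfl _, Or.inl ?_⟩
    simp [NExp.val]
  · rintro s' ⟨⟨i, h1, h2⟩, hb⟩
    have hs' := h1.base hd ha hs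
    simp only [Test.Holds, NExp.val, he n s' hs'] at hb
    refine ⟨h1, ?_⟩
    rcases h2 with ⟨h0, hle, hi, hall⟩ | ⟨h0, -, h2⟩
    · exact Or.inl ⟨h0, fun j hj => hall j (by omega)⟩
    · exact Or.inr ⟨h0, h2⟩

/-- The first free scalar `d` plays the role of the bound variable, as a de Bruijn level. The
hypothesis `hφ` says that `φ` sees this scalar only through its last argument. -/
theorem ex {φ : ∀ n, Input k n → (ℕ → ℕ → ℕ) → ℕ → Prop} {b : ℕ → ℕ} (hd : 2 ≤ d)
    (hb : IsBound k C b) (h : Dec k C (d + 1) a fun n I g => φ n I g (g 1 d))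
    (hφ : ∀ n I g i j, φ n I (setScalar g d i) j ↔ φ n I g j) :
    Dec k C d a fun n I g => ∃ i < b n, φ n I g i := by
  obtain ⟨p, t, ht, hp⟩ := find hd hb h hφ
  refine ⟨hd, h.three_le, fun n I g g' hg => ?_, p, t, ht, fun n I s hs =>
    (hp n I s hs).mono le_rfl ?_⟩
  · refine exists_congr fun i => and_congr_right fun _ => ?_
    have := h.congr n I _ _ (hg.setScalar i)
    rwa [setScalar_one, setScalar_one, hφ, hφ] at this
  · rintro s' ⟨h1, h2⟩
    refine ⟨h1, ?_⟩
    rcases h2 with ⟨h0, h2⟩ | ⟨h0, h2, h3⟩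
    · rw [h0, ind_false]
      rintro ⟨i, hi, hφ⟩
      exact h2 i hi hφ
    · rw [h0, ind_true ⟨_, h2, h3⟩]

theorem all {φ : ∀ n, Input k n → (ℕ → ℕ → ℕ) → ℕ → Prop} {b : ℕ → ℕ} (hd : 2 ≤ d)
    (hb : IsBound k C b) (h : Dec k C (d + 1) a fun n I g => φ n I g (g 1 d))
    (hφ : ∀ n I g i j, φ n I (setScalar g d i) j ↔ φ n I g j) :
    Dec k C d a fun n I g => ∀ i < b n, φ n I g i :=
  (ex (φ := fun n I g i => ¬ φ n I g i) hd hb h.not fun n I g i j =>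
    not_congr (hφ n I g i j)).not.iff fun n I g => by push Not; rfl

end Dec

end

section

/-! ### Fixpoints -/

/-- The sets (as `0`-`1`-arrays) that arise from the empty set by adding elements below `b` that
are forced by `ψ`. -/
inductive Generated (b : ℕ) (ψ : (ℕ → ℕ) → ℕ → Prop) : (ℕ → ℕ) → Prop
  | empty (A : ℕ → ℕ) : (∀ z < b, A z = 0) → Generated b ψ A
  | insert (A : ℕ → ℕ) (z : ℕ) : Generated b ψ A → z < b → A z = 0 → ψ A z →
      Generated b ψ (Function.update A z 1)

/-- Every element forced by `ψ` is present. -/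
def IsClosedUnder (b : ℕ) (ψ : (ℕ → ℕ) → ℕ → Prop) (A : ℕ → ℕ) : Prop :=
  ∀ z < b, A z = 0 → ¬ ψ A z

variable {k C d a : ℕ}

theorem exists_reset {b : ℕ → ℕ} (hd : 2 ≤ d) (ha : 3 ≤ a) (hb : IsBound k C b) :
    ∃ (p : Prog) (t : ℕ → ℕ), Subexp t ∧ ∀ n (I : Input k n) (s : Memory), Base k C n s.nat →
    Runs I p s (t n) fun s' => Agree d a s.nat s'.nat ∧ ∀ z < b n, s'.nat a z = 0 := by
  obtain ⟨hbs, e, he⟩ := hb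
  refine ⟨.seq (.setNat 1 (.lit d) (.lit 0)) (.loop (.natLt (.get 1 (.lit d)) e)
    (.seq (.setNat a (.get 1 (.lit d)) (.lit 0))
      (.setNat 1 (.lit d) (.add (.get 1 (.lit d)) (.lit 1))))), _,
    (Subexp.const 1).add ((hbs.mul (.const 3)).add (.const 1)), fun n I s hs => ?_⟩
  let Inv : ℕ → Memory → Prop := fun i s' => Agree d a s.nat s'.nat ∧ i = b n - s'.nat 1 d ∧
    ∀ z < s'.nat 1 d, s'.nat a z = 0
  refine Runs.seq (Runs.setNat ((Runs.loop (t := 2) Inv ?_ (b n) ?_).mono le_rfl ?_))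
  · rintro i s' ⟨h1, h2, h3⟩ hb
    have hs' := h1.base hd ha hs
    simp only [Test.Holds, NExp.val, he n s' hs'] at hb
    refine Runs.seq (t := 1) (t' := 1) (Runs.setNat (Runs.setNat ?_))
    refine ⟨b n - (s'.nat 1 d + 1), by omega,
      (h1.write_array ha le_rfl _).write_scalar le_rfl _, ?_, fun z hz => ?_⟩
    · simp [NExp.val, Function.update_of_ne (show 1 ≠ a by omega)]
    · simp only [NExp.val, Memory.setNat_nat, Function.update_self,
        Function.update_of_ne (show 1 ≠ a by omega)] at hz
      simp only [NExp.val, Memory.setNat_nat, Function.update_self,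
        Function.update_of_ne (show 1 ≠ a by omega), Function.update_of_ne (show a ≠ 1 by omega)]
      rcases Nat.lt_succ_iff_lt_or_eq.1 hz with hz | rfl
      · rw [Function.update_of_ne (by omega)]; exact h3 z hz
      · simp
  · exact ⟨(Agree.refl _ _ _).write_scalar le_rfl _, by simp [NExp.val], by simp [NExp.val]⟩
  · rintro s' ⟨⟨i, h1, h2, h3⟩, hb⟩
    simp only [Test.Holds, NExp.val, he n s' (h1.base hd ha hs)] at hb
    exact ⟨h1, fun z hz => h3 z (by omega)⟩

-- The number of absent elements is the variant of the fixpoint loop.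
open Classical in
theorem card_filter_update_lt {b z : ℕ} {A : ℕ → ℕ} (hz : z < b) (h : A z = 0) :
    ((Finset.range b).filter fun j => Function.update A z 1 j = 0).card <
      ((Finset.range b).filter fun j => A j = 0).card := by
  refine Finset.card_lt_card ⟨fun j hj => ?_, fun hsub => ?_⟩
  · rw [Finset.mem_filter] at hj ⊢
    refine ⟨hj.1, ?_⟩
    rcases eq_or_ne j z with rfl | hne
    · exact h
    · rw [← hj.2, Function.update_of_ne hne]
  · have := hsub (Finset.mem_filter.2 ⟨Finset.mem_range.2 hz, h⟩)
    simp at this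

namespace Dec

/-- Compute a fixpoint, and decide a predicate with its help. -/
theorem fix {b : ℕ → ℕ} {ψ : ∀ n, Input k n → (ℕ → ℕ → ℕ) → (ℕ → ℕ) → ℕ → Prop}
    {φ : ∀ n, Input k n → (ℕ → ℕ → ℕ) → (ℕ → ℕ) → Prop}
    {Φ : ∀ n, Input k n → (ℕ → ℕ → ℕ) → Prop} (hb : IsBound k C b)
    (hψ : Dec k C (d + 1) (a + 1) fun n I g => ψ n I g (g a) (g 1 d))
    (hψi : ∀ n I g X i A z, ψ n I (setScalar (Function.update g a X) d i) A z ↔ ψ n I g A z)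
    (hφ : Dec k C d (a + 1) fun n I g => φ n I g (g a))
    (hφi : ∀ n I g X A, φ n I (Function.update g a X) A ↔ φ n I g A) (hd : 2 ≤ d) (ha : 3 ≤ a)
    (hΦc : ∀ n I g g', Agree d a g g' → (Φ n I g ↔ Φ n I g'))
    (hΦ : ∀ n I g A, Base k C n g → Generated (b n) (ψ n I g) A →
      IsClosedUnder (b n) (ψ n I g) A → (φ n I g A ↔ Φ n I g)) : Dec k C d a Φ := by
  classical
  have hψc : ∀ n I g g' A z, Agree d a g g' → (ψ n I g A z ↔ ψ n I g' A z) := by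
    intro n I g g' A z hg
    have := hψ.congr n I _ _ ((hg.update (by omega) A).setScalar z)
    simp only [hψi, setScalar_one] at this
    rwa [setScalar_of_ne _ _ _ (by omega), setScalar_of_ne _ _ _ (by omega), Function.update_self,
      Function.update_self] at this
  have hφc : ∀ n I g g' A, Agree d a g g' → (φ n I g A ↔ φ n I g' A) := by
    intro n I g g' A hg
    have := hφ.congr n I _ _ (hg.update (by omega) A)
    simpa only [hφi, Function.update_self] using this
  obtain ⟨p₀, t₀, ht₀, hp₀⟩ := exists_reset (a := a) hd ha hb
  obtain ⟨p₁, t₁, ht₁, hp₁⟩ := find (a := a + 1)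
    (φ := fun n I g z => g a z = 0 ∧ ψ n I g (g a) z) hd hb
    ((eq (by omega) (by omega) ((IsTerm.scalar (Nat.lt_succ_self d)).get (by omega)
      (Nat.lt_succ_self a)) (.lit 0)).and hψ) (fun n I g i j => by
        have := hψi n I g (g a) i (g a) j
        rw [Function.update_eq_self] at this
        rw [setScalar_of_ne _ _ _ (show a ≠ 1 by omega), this])
  obtain ⟨p₂, t₂, ht₂, hp₂⟩ := hφ.run
  refine ⟨hd, ha, hΦc, .seq p₀ (.seq (.setNat 0 (.lit 0) (.lit 1)) (.seq
    (.loop (.natLt (.lit 0) (.get 0 (.lit 0))) (.seq p₁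
      (.ite (.natLt (.lit 0) (.get 0 (.lit 0))) (.setNat a (.get 1 (.lit d)) (.lit 1))
        (.setNat 0 (.lit 0) (.lit 0))))) p₂)), _,
    ht₀.add ((Subexp.const 1).add ((((hb.subexp.add (.const 1)).mul ((ht₁.add (.const 2)).add
      (.const 1))).add (.const 1)).add ht₂)), fun n I s hs => Runs.seq ((hp₀ n I s hs).mono le_rfl
    fun s₀ h₀ => Runs.seq (Runs.setNat (Runs.seq ?_)))⟩
  -- Flag `1` means that the last round inserted an element, or that no round has taken place. The
  -- `1` added to the variant pays for the final round, which finds nothing to insert and certifies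
  -- closedness.
  let Inv : ℕ → Memory → Prop := fun i s' => Agree d a s.nat s'.nat ∧
    Generated (b n) (ψ n I s.nat) (s'.nat a) ∧
    ((s'.nat 0 0 = 1 ∧ i = ((Finset.range (b n)).filter fun j => s'.nat a j = 0).card + 1) ∨
      (s'.nat 0 0 = 0 ∧ IsClosedUnder (b n) (ψ n I s.nat) (s'.nat a)))
  have hcard : ∀ A : ℕ → ℕ, ((Finset.range (b n)).filter fun j => A j = 0).card ≤ b n := fun A =>
    (Finset.card_filter_le _ _).trans (by simp)
  refine ((Runs.loop (t := t₁ n + 2) Inv ?_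
    (((Finset.range (b n)).filter fun j => s₀.nat a j = 0).card + 1) ?_).mono ?_ ?_)
  · rintro i s₁ ⟨h1, h2, h3⟩ hb'
    have hs₁ := h1.base hd ha hs
    simp only [Test.Holds, NExp.val] at hb'
    rcases h3 with ⟨h3, hi⟩ | ⟨h3, -⟩
    swap
    · omega
    refine Runs.seq (t := t₁ n) (t' := 2) ((hp₁ n I s₁ hs₁).mono le_rfl ?_)
    rintro s₂ ⟨h4, h5⟩
    have h6 := h1.trans (h4.mono le_rfl (Nat.le_succ a))
    have h7 : s₁.nat a = s₂.nat a := h4.2 a (by omega) (Nat.lt_succ_self a)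
    simp only [hψc n I _ _ _ _ h1.symm, h7] at h5
    rw [h7] at h2 hi
    refine Runs.ite (t := 1) (fun hb' => Runs.setNat ?_) fun hb' => Runs.setNat ?_
    · simp only [Test.Holds, NExp.val] at hb'
      obtain ⟨h8, h9, h10, h11⟩ : s₂.nat 0 0 = 1 ∧ s₂.nat 1 d < b n ∧
          s₂.nat a (s₂.nat 1 d) = 0 ∧ ψ n I s.nat (s₂.nat a) (s₂.nat 1 d) := by
        rcases h5 with h5 | h5
        · omega
        · exact h5
      refine ⟨_, ?_, h6.write_array ha le_rfl _, ?_, Or.inl ⟨?_, rfl⟩⟩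
      · have := card_filter_update_lt h9 h10
        simp only [NExp.val, Memory.setNat_nat, Function.update_self]
        omega
      · simp only [NExp.val, Memory.setNat_nat, Function.update_self]
        exact .insert _ _ h2 h9 h10 h11
      · simp only [Memory.setNat_nat, Function.update_of_ne (show 0 ≠ a by omega)]
        exact h8
    · simp only [Test.Holds, NExp.val] at hb'
      refine ⟨0, by omega, h6.write_result _, ?_, Or.inr ⟨?_, ?_⟩⟩
      · simpa only [Memory.setNat_nat, Function.update_of_ne (show a ≠ 0 by omega)] using h2
      · simp [NExp.val]
      · rcases h5 with h5 | h5
        · simp only [Memory.setNat_nat, Function.update_of_ne (show a ≠ 0 by omega)]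
          exact fun z hz h8 h9 => h5.2 z hz ⟨h8, h9⟩
        · omega
  · refine ⟨h₀.1.write_result _, .empty _ ?_, Or.inl ⟨by simp [NExp.val], ?_⟩⟩
    · simpa only [Memory.setNat_nat, Function.update_of_ne (show a ≠ 0 by omega)] using h₀.2
    · simp only [Memory.setNat_nat, Function.update_of_ne (show a ≠ 0 by omega)]
  · exact Nat.add_le_add_right (Nat.mul_le_mul_right _ (Nat.add_le_add_right (hcard _) 1)) 1
  · rintro s₁ ⟨⟨i, h1, h2, h3⟩, hb'⟩
    simp only [Test.Holds, NExp.val] at hb'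
    obtain ⟨-, h3⟩ : s₁.nat 0 0 = 0 ∧ IsClosedUnder (b n) (ψ n I s.nat) (s₁.nat a) := by
      rcases h3 with h3 | h3
      · omega
      · exact h3
    refine (hp₂ n I s₁ (h1.base hd ha hs)).mono le_rfl ?_
    rintro s₂ ⟨h4, h5⟩
    refine ⟨h1.trans (h4.mono le_rfl (Nat.le_succ a)), ?_⟩
    rw [h5]
    exact congrArg ind (propext ((hφc n I _ _ _ h1).symm.trans (hΦ n I s.nat _ hs h2 h3)))

end Dec

/-! ### Exhaustive search -/

/-- The number with the given digits. -/
def digitValue (B T : ℕ) (X : ℕ → ℕ) : ℕ := ∑ j ∈ Finset.range T, X j * B ^ j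

theorem digitValue_lt {B T : ℕ} {X : ℕ → ℕ} (h : ∀ j < T, X j < B) :
    digitValue B T X < B ^ T := by
  induction T with
  | zero => simp [digitValue]
  | succ T ih =>
    have h1 := ih fun j hj => h j (by omega)
    have h2 : (X T + 1) * B ^ T ≤ B * B ^ T := Nat.mul_le_mul_right _ (h T (by omega))
    simp only [digitValue, Finset.sum_range_succ] at h1 ⊢
    rw [pow_succ, mul_comm (B ^ T)]
    nlinarith

theorem digitValue_inj {B T : ℕ} {X Y : ℕ → ℕ} (hX : ∀ j < T, X j < B) (hY : ∀ j < T, Y j < B)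
    (h : digitValue B T X = digitValue B T Y) : ∀ j < T, X j = Y j := by
  induction T with
  | zero => simp
  | succ T ih =>
    have h1 := digitValue_lt (fun j (hj : j < T) => hX j (by omega))
    have h2 := digitValue_lt (fun j (hj : j < T) => hY j (by omega))
    have h3 : digitValue B T X + B ^ T * X T = digitValue B T Y + B ^ T * Y T := by
      simp only [digitValue, Finset.sum_range_succ] at h ⊢
      linarith
    have hpos : 0 < B ^ T := by omega
    have h4 : X T = Y T := by
      have := congrArg (· / B ^ T) h3
      simpa [Nat.add_mul_div_left _ _ hpos, Nat.div_eq_of_lt h1, Nat.div_eq_of_lt h2] using this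
    have h5 : digitValue B T X = digitValue B T Y := by rw [h4] at h3; omega
    intro j hj
    rcases Nat.lt_succ_iff_lt_or_eq.1 hj with hj | rfl
    · exact ih (fun j hj => hX j (by omega)) (fun j hj => hY j (by omega)) h5 j hj
    · exact h4

theorem digitValue_update {B T i : ℕ} (X : ℕ → ℕ) (x : ℕ) (hi : i < T) :
    digitValue B T (Function.update X i x) + X i * B ^ i = digitValue B T X + x * B ^ i := by
  have hmem : i ∈ Finset.range T := Finset.mem_range.2 hi
  rw [digitValue, digitValue, ← Finset.add_sum_erase _ _ hmem, ← Finset.add_sum_erase _ _ hmem]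
  have : ∑ j ∈ (Finset.range T).erase i, Function.update X i x j * B ^ j =
      ∑ j ∈ (Finset.range T).erase i, X j * B ^ j :=
    Finset.sum_congr rfl fun j hj => by rw [Function.update_of_ne (Finset.ne_of_mem_erase hj)]
  rw [this, Function.update_self]
  ring

/-- Increment the number with digits at most `k * n` in array `a`; the result is `2` in case of
an overflow. -/
theorem exists_increment (k C : ℕ) (hd : 2 ≤ d) (ha : 3 ≤ a) :
    ∃ (p : Prog) (t : ℕ → ℕ), Subexp t ∧ ∀ n (I : Input k n) (s : Memory), Base k C n s.nat →
    s.nat 0 0 = 0 → (∀ j < slots C n, s.nat a j ≤ k * n) →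
    Runs I p s (t n) fun s' => Agree d a s.nat s'.nat ∧ (∀ j < slots C n, s'.nat a j ≤ k * n) ∧
      ((s'.nat 0 0 = 0 ∧ digitValue (k * n + 1) (slots C n) (s'.nat a) =
          digitValue (k * n + 1) (slots C n) (s.nat a) + 1) ∨
        (s'.nat 0 0 = 2 ∧ (k * n + 1) ^ slots C n =
          digitValue (k * n + 1) (slots C n) (s.nat a) + 1)) := by
  obtain ⟨eN, heN⟩ := ((IsTerm.objects (k := k) (C := C) (d := d) (a := a)).smul k).eval
  refine ⟨.seq (.setNat 1 (.lit d) (.lit 0)) (.seq (.loop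
      (.and (.natLt (.get 1 (.lit d)) (.get 1 (.lit 0)))
        (.neg (.natLt (.get a (.get 1 (.lit d))) eN)))
      (.seq (.setNat a (.get 1 (.lit d)) (.lit 0))
        (.setNat 1 (.lit d) (.add (.get 1 (.lit d)) (.lit 1)))))
      (.ite (.natLt (.get 1 (.lit d)) (.get 1 (.lit 0)))
        (.setNat a (.get 1 (.lit d)) (.add (.get a (.get 1 (.lit d))) (.lit 1)))
        (.setNat 0 (.lit 0) (.lit 2)))), _,
    (Subexp.const 1).add ((((IsBound.slots (k := k) (C := C)).subexp.mul (.const 3)).add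
      (.const 1)).add (.const 2)), fun n I s hs h0 hX => ?_⟩
  set T := slots C n
  set B := k * n + 1 with hB
  -- The digits already passed are `0`, and the pending carry is worth `B` to the power of the
  -- current position. An overflow is a carry that has reached position `T`.
  let Inv : ℕ → Memory → Prop := fun i s' => Agree d a s.nat s'.nat ∧ s'.nat 0 0 = 0 ∧
    (∀ j < T, s'.nat a j ≤ k * n) ∧ s'.nat 1 d ≤ T ∧ i = T - s'.nat 1 d ∧
    digitValue B T (s'.nat a) + B ^ (s'.nat 1 d) = digitValue B T (s.nat a) + 1 ∧
    ∀ j < s'.nat 1 d, s'.nat a j = 0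
  refine Runs.seq (Runs.setNat (Runs.seq ((Runs.loop (t := 2) Inv ?_ T ?_).mono le_rfl ?_)))
  · rintro i s' ⟨h1, h2, h3, h4, h5, h6, h7⟩ hb
    have hs' := h1.base hd ha hs
    simp only [Test.Holds, NExp.val, heN n s' hs', hs'.slots] at hb
    have hdig : s'.nat a (s'.nat 1 d) = k * n := le_antisymm (h3 _ hb.1) (by omega)
    refine Runs.seq (t := 1) (t' := 1) (Runs.setNat (Runs.setNat ?_))
    refine ⟨T - (s'.nat 1 d + 1), by omega,
      (h1.write_array ha le_rfl _).write_scalar le_rfl _, ?_⟩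
    simp only [NExp.val, Memory.setNat_nat, Function.update_self,
        Function.update_of_ne (show 1 ≠ a by omega), Function.update_of_ne (show a ≠ 1 by omega),
        Function.update_of_ne (show 0 ≠ a by omega), Function.update_of_ne (show 0 ≠ 1 by omega)]
    refine ⟨h2, fun j hj => ?_, by omega, trivial, ?_, fun j hj => ?_⟩
    · rcases eq_or_ne j (s'.nat 1 d) with rfl | hne
      · simp
      · rw [Function.update_of_ne hne]; exact h3 j hj
    · have := digitValue_update (B := B) (T := T) (s'.nat a) 0 hb.1
      rw [hdig] at this
      rw [pow_succ, ← h6]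
      have hBk : B ^ s'.nat 1 d * B = k * n * B ^ s'.nat 1 d + B ^ s'.nat 1 d := by rw [hB]; ring
      omega
    · rcases Nat.lt_succ_iff_lt_or_eq.1 hj with hj | rfl
      · rw [Function.update_of_ne (by omega)]; exact h7 j hj
      · simp
  · refine ⟨(Agree.refl _ _ _).write_scalar le_rfl _, ?_⟩
    simp only [NExp.val, Memory.setNat_nat, Function.update_self,
        Function.update_of_ne (show a ≠ 1 by omega), Function.update_of_ne (show 0 ≠ 1 by omega)]
    exact ⟨h0, hX, by omega, by omega, by simp, by omega⟩
  · rintro s' ⟨⟨i, h1, h2, h3, h4, h5, h6, h7⟩, hb⟩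
    have hs' := h1.base hd ha hs
    simp only [Test.Holds, NExp.val, heN n s' hs', hs'.slots] at hb
    refine Runs.ite (t := 1) (fun hb' => Runs.setNat ?_) fun hb' => Runs.setNat ?_
    · simp only [Test.Holds, NExp.val, hs'.slots] at hb'
      have hdig : s'.nat a (s'.nat 1 d) < k * n := by
        by_contra hcon
        exact hb ⟨hb', hcon⟩
      refine ⟨h1.write_array ha le_rfl _, ?_⟩
      simp only [NExp.val, Memory.setNat_nat, Function.update_self,
        Function.update_of_ne (show 0 ≠ a by omega)]
      refine ⟨fun j hj => ?_, Or.inl ⟨h2, ?_⟩⟩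
      · rcases eq_or_ne j (s'.nat 1 d) with rfl | hne
        · simpa using hdig
        · rw [Function.update_of_ne hne]; exact h3 j hj
      · have := digitValue_update (B := B) (T := T) (s'.nat a) (s'.nat a (s'.nat 1 d) + 1) hb'
        rw [add_mul] at this
        omega
    · simp only [Test.Holds, NExp.val, hs'.slots] at hb'
      have hT : s'.nat 1 d = T := le_antisymm h4 (not_lt.1 hb')
      refine ⟨h1.write_result _, ?_⟩
      simp only [NExp.val, Memory.setNat_nat, Function.update_self,
        Function.update_of_ne (show a ≠ 0 by omega)]
      refine ⟨h3, Or.inr ⟨trivial, ?_⟩⟩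
      have h0 : digitValue B T (s'.nat a) = 0 :=
        Finset.sum_eq_zero fun j hj => by rw [h7 j (by simpa [hT] using hj), zero_mul]
      rw [hT] at h6
      omega

namespace Dec

/-- Exhaustive search for a guess. -/
theorem search {φ : ∀ n, Input k n → (ℕ → ℕ → ℕ) → (ℕ → ℕ) → Prop} (hd : 2 ≤ d) (ha : 3 ≤ a)
    (hφ : Dec k C d (a + 1) fun n I g => φ n I g (g a))
    (hφi : ∀ n I g X A, φ n I (Function.update g a X) A ↔ φ n I g A)
    (hφT : ∀ n I g X X', (∀ j < slots C n, X j = X' j) → φ n I g X → φ n I g X') :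
    Dec k C d a fun n I g => ∃ X : ℕ → ℕ, (∀ j < slots C n, X j ≤ k * n) ∧ φ n I g X := by
  have hφc : ∀ n I g g' A, Agree d a g g' → (φ n I g A ↔ φ n I g' A) := by
    intro n I g g' A hg
    have := hφ.congr n I _ _ (hg.update (by omega) A)
    simpa only [hφi, Function.update_self] using this
  obtain ⟨p₀, t₀, ht₀, hp₀⟩ := exists_reset (a := a) hd ha (IsBound.slots (k := k) (C := C))
  obtain ⟨p₁, t₁, ht₁, hp₁⟩ := hφ.run
  obtain ⟨p₂, t₂, ht₂, hp₂⟩ := exists_increment k C hd ha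
  refine ⟨hd, ha, fun n I g g' hg => exists_congr fun X => and_congr_right fun _ =>
      hφc n I g g' X hg, .seq p₀ (.seq (.setNat 0 (.lit 0) (.lit 0)) (.seq
    (.loop (.natLt (.get 0 (.lit 0)) (.lit 1)) (.seq p₁
      (.ite (.natLt (.get 0 (.lit 0)) (.lit 1)) p₂ (.setNat 0 (.lit 0) (.lit 1)))))
    (.ite (.natLt (.lit 1) (.get 0 (.lit 0))) (.setNat 0 (.lit 0) (.lit 0))
      (.setNat 0 (.lit 0) (.lit 1))))), _,
    ht₀.add ((Subexp.const 1).add ((((Subexp.pow_cubeRoot k C).mul ((ht₁.add ((Subexp.const 1).add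
      (ht₂.add (.const 1)))).add (.const 1))).add (.const 1)).add (.const 2))),
    fun n I s hs => Runs.seq ((hp₀ n I s hs).mono le_rfl fun s₀ h₀ => Runs.seq
      (Runs.setNat (Runs.seq ?_)))⟩
  set T := slots C n
  set B := k * n + 1 with hB
  -- The guesses are traversed in the order of their values in base `k * n + 1`, and all smaller
  -- ones have been rejected. Flag `0` means that the search goes on, `1` that a guess was accepted,
  -- `2` that all are exhausted.
  let Inv : ℕ → Memory → Prop := fun i s' => Agree d a s.nat s'.nat ∧
    (∀ j < T, s'.nat a j ≤ k * n) ∧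
    ((s'.nat 0 0 = 0 ∧ i = B ^ T - digitValue B T (s'.nat a) ∧
        ∀ Y : ℕ → ℕ, (∀ j < T, Y j ≤ k * n) → digitValue B T Y < digitValue B T (s'.nat a) →
          ¬ φ n I s.nat Y) ∨
      (s'.nat 0 0 = 1 ∧ i = 0 ∧ φ n I s.nat (s'.nat a)) ∨
      (s'.nat 0 0 = 2 ∧ i = 0 ∧ ∀ Y : ℕ → ℕ, (∀ j < T, Y j ≤ k * n) → ¬ φ n I s.nat Y))
  refine ((Runs.loop (t := t₁ n + (1 + (t₂ n + 1))) Inv ?_ (B ^ T) ?_).mono le_rfl ?_)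
  · rintro i s₁ ⟨h1, h2, h3⟩ hb'
    have hs₁ := h1.base hd ha hs
    simp only [Test.Holds, NExp.val] at hb'
    rcases h3 with ⟨h3, hi, hY⟩ | ⟨h3, -⟩ | ⟨h3, -⟩
    rotate_left
    · omega
    · omega
    have hlt := digitValue_lt (B := B) (T := T) (X := s₁.nat a) fun j hj =>
      Nat.lt_succ_of_le (h2 j hj)
    refine Runs.seq ((hp₁ n I s₁ hs₁).mono le_rfl ?_)
    rintro s₂ ⟨h4, h5⟩
    have h6 := h1.trans (h4.mono le_rfl (Nat.le_succ a))
    have h7 : s₁.nat a = s₂.nat a := h4.2 a (by omega) (Nat.lt_succ_self a)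
    rw [hφc n I _ _ _ h1.symm, h7] at h5
    rw [h7] at h2 hi hY hlt
    refine Runs.ite (fun hb' => ?_) fun hb' => ?_
    · simp only [Test.Holds, NExp.val, h5, ind_lt_one] at hb'
      have hnot : ∀ Y : ℕ → ℕ, (∀ j < T, Y j ≤ k * n) →
          digitValue B T Y < digitValue B T (s₂.nat a) + 1 → ¬ φ n I s.nat Y := by
        intro Y hY1 hY2 hY3
        rcases Nat.lt_succ_iff_lt_or_eq.1 hY2 with hY2 | hY2
        · exact hY Y hY1 hY2 hY3
        · exact hb' (hφT n I s.nat Y _ (digitValue_inj (fun j hj => Nat.lt_succ_of_le (hY1 j hj))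
            (fun j hj => Nat.lt_succ_of_le (h2 j hj)) hY2) hY3)
      refine (hp₂ n I s₂ (h6.base hd ha hs) (by rw [h5, ind_false hb']) h2).mono (by omega) ?_
      rintro s₃ ⟨h8, h9, h10⟩
      rcases h10 with ⟨h10, h11⟩ | ⟨h10, h11⟩
      · refine ⟨_, ?_, h6.trans h8, h9, Or.inl ⟨h10, rfl, ?_⟩⟩
        · change digitValue B T (s₃.nat a) = digitValue B T (s₂.nat a) + 1 at h11
          omega
        · rwa [h11]
      · refine ⟨0, by omega, h6.trans h8, h9, Or.inr (Or.inr ⟨h10, rfl, fun Y hY => ?_⟩)⟩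
        refine hnot Y hY ?_
        rw [← h11]
        exact digitValue_lt fun j hj => Nat.lt_succ_of_le (hY j hj)
    · simp only [Test.Holds, NExp.val, h5, ind_lt_one, not_not] at hb'
      refine (Runs.setNat ?_).mono (show 1 ≤ _ by omega) fun _ h => h
      refine ⟨0, by omega, h6.write_result _, ?_⟩
      simp only [NExp.val, Memory.setNat_nat, Function.update_self,
        Function.update_of_ne (show a ≠ 0 by omega)]
      exact ⟨h2, Or.inr (Or.inl ⟨trivial, trivial, hb'⟩)⟩
  · refine ⟨h₀.1.write_result _, ?_⟩
    simp only [NExp.val, Memory.setNat_nat, Function.update_self,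
      Function.update_of_ne (show a ≠ 0 by omega)]
    have h0 : digitValue B T (s₀.nat a) = 0 :=
      Finset.sum_eq_zero fun j hj => by rw [h₀.2 j (by simpa using hj), zero_mul]
    refine ⟨fun j hj => by simp [h₀.2 j hj], Or.inl ⟨trivial, by simp [h0], fun Y _ h => ?_⟩⟩
    omega
  · rintro s₁ ⟨⟨i, h1, h2, h3⟩, hb'⟩
    simp only [Test.Holds, NExp.val] at hb'
    refine Runs.ite (t := 1) (fun hb => Runs.setNat ?_) fun hb => Runs.setNat ?_
    all_goals
      refine ⟨h1.write_result _, ?_⟩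
      simp only [Test.Holds, NExp.val] at hb
      simp only [NExp.val, Memory.setNat_nat, Function.update_self]
      rcases h3 with h3 | h3 | h3
    · omega
    · omega
    · rw [ind_false]
      rintro ⟨X, hX, hX'⟩
      exact h3.2.2 X hX hX'
    · omega
    · rw [ind_true]
      exact ⟨_, h2, h3.2.2⟩
    · omega

end Dec

/-! ### The preparations -/

theorem exists_mul_expr (c : ℕ) (e : NExp) :
    ∃ e' : NExp, ∀ n s, e'.val n s = c * e.val n s := by
  induction c with
  | zero => exact ⟨.lit 0, fun n s => by simp [NExp.val]⟩
  | succ c ih =>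
    obtain ⟨e', h⟩ := ih
    exact ⟨.add e' e, fun n s => by simp [NExp.val, h, add_mul]⟩

/-- Scalars `2`, `3`, `4` run through `m`, `m ^ 2`, `m ^ 3` by means of the binomial formulas, until
the cube reaches `n`; the cube is updated first because it needs the old values. The table of
multiples of `k * n` is filled by repeated addition, and its last entry is the number of pairs. -/
theorem exists_setup (k C : ℕ) :
    ∃ (p : Prog) (t : ℕ → ℕ), Subexp t ∧ ∀ n (I : Input k n),
    Runs I p Memory.init (t n) fun s' => Base k C n s'.nat := by
  obtain ⟨eT, heT⟩ := exists_mul_expr C (.get 1 (.lit 3))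
  obtain ⟨eN, heN⟩ := exists_mul_expr k .numObjects
  obtain ⟨e3, he3⟩ := exists_mul_expr 3 (.get 1 (.lit 3))
  obtain ⟨e2, he2⟩ := exists_mul_expr 3 (.get 1 (.lit 2))
  refine ⟨.seq (.loop (.natLt (.get 1 (.lit 4)) .numObjects)
      (.seq (.setNat 1 (.lit 4) (.add (.add (.add (.get 1 (.lit 4)) e3) e2) (.lit 1)))
        (.seq (.setNat 1 (.lit 3)
          (.add (.add (.get 1 (.lit 3)) (.add (.get 1 (.lit 2)) (.get 1 (.lit 2)))) (.lit 1)))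
          (.setNat 1 (.lit 2) (.add (.get 1 (.lit 2)) (.lit 1))))))
    (.seq (.setNat 1 (.lit 0) eT) (.seq (.setNat 1 (.lit 5) eN)
      (.seq (.loop (.natLt (.get 1 (.lit 6)) (.get 1 (.lit 5)))
        (.seq (.setNat 2 (.add (.get 1 (.lit 6)) (.lit 1))
            (.add (.get 2 (.get 1 (.lit 6))) (.get 1 (.lit 5))))
          (.setNat 1 (.lit 6) (.add (.get 1 (.lit 6)) (.lit 1)))))
        (.setNat 1 (.lit 1) (.get 2 (.get 1 (.lit 5))))))), _,
    ((Subexp.id.mul (.const 4)).add (.const 1)).add ((Subexp.const 1).add ((Subexp.const 1).add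
      (((((Subexp.const k).mul .id).mul (.const 3)).add (.const 1)).add (.const 1)))),
    fun n I => Runs.seq ?_⟩
  let Inv : ℕ → Memory → Prop := fun i s => s.nat 1 2 ≤ cubeRoot n ∧ i = cubeRoot n - s.nat 1 2 ∧
    s.nat 1 3 = s.nat 1 2 ^ 2 ∧ s.nat 1 4 = s.nat 1 2 ^ 3 ∧ s.nat 1 6 = 0 ∧ s.nat 2 0 = 0
  refine (Runs.loop (t := 3) Inv ?_ (cubeRoot n) ?_).mono ?_ ?_
  · rintro i s ⟨h1, h2, h3, h4, h5, h6⟩ hb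
    simp only [Test.Holds, NExp.val] at hb
    have hlt : s.nat 1 2 < cubeRoot n := by
      by_contra hcon
      have := Nat.pow_le_pow_left (not_lt.1 hcon) 3
      have := le_cubeRoot n
      omega
    refine Runs.seq (t := 1) (t' := 2) (Runs.setNat (Runs.seq (t := 1) (t' := 1)
      (Runs.setNat (Runs.setNat ⟨cubeRoot n - (s.nat 1 2 + 1), by omega, ?_⟩))))
    simp [Inv, NExp.val, he3, he2, h3, h4, h5, h6]
    refine ⟨by omega, ?_, ?_⟩ <;> ring
  · simp [Inv, Memory.init]
  · have : cubeRoot n ≤ n := cubeRoot_le (Nat.le_self_pow (by norm_num) n)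
    omega
  rintro s ⟨⟨i, h1, h2, h3, h4, h5, h6⟩, hb⟩
  simp only [Test.Holds, NExp.val, not_lt] at hb
  have hm : s.nat 1 2 = cubeRoot n := le_antisymm h1 (cubeRoot_le (h4 ▸ hb))
  refine Runs.seq (Runs.setNat (Runs.seq (Runs.setNat (Runs.seq ?_))))
  let Inv' : ℕ → Memory → Prop := fun i s => s.nat 1 0 = slots C n ∧ s.nat 1 5 = k * n ∧
    s.nat 1 6 ≤ k * n ∧ i = k * n - s.nat 1 6 ∧ ∀ x ≤ s.nat 1 6, s.nat 2 x = x * (k * n)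
  refine (Runs.loop (t := 2) Inv' ?_ (k * n) ?_).mono le_rfl ?_
  · rintro i s ⟨h1, h2, h3, h4, h5⟩ hb
    simp only [Test.Holds, NExp.val] at hb
    refine Runs.seq (t := 1) (t' := 1) (Runs.setNat (Runs.setNat
      ⟨k * n - (s.nat 1 6 + 1), by omega, ?_⟩))
    simp [Inv', NExp.val]
    refine ⟨h1, h2, by omega, fun x hx => ?_⟩
    rcases Nat.le_succ_iff.1 hx with hx | rfl
    · rw [Function.update_of_ne (by omega)]; exact h5 x hx
    · rw [Nat.succ_eq_add_one, Function.update_self, h5 _ le_rfl, h2, add_mul, one_mul]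
  · simp [Inv', NExp.val, heT, heN, h3, hm, h5, h6, slots]
  · rintro s' ⟨⟨i, h1, h2, h3, h4, h5⟩, hb⟩
    simp only [Test.Holds, NExp.val, h2, not_lt] at hb
    have hx : s'.nat 1 6 = k * n := by omega
    rw [hx] at h5
    refine Runs.setNat ⟨?_, ?_, fun x hx => ?_⟩
    · simpa [NExp.val] using h1
    · simp [NExp.val, h2, h5]
    · simpa [NExp.val] using h5 x hx.le

end

section

/-! ### Path consistency for variables with at most two values -/

/-- Helly's theorem for subsets of a set with at most two elements. -/
theorem exists_common {ι : Type*} {U : Finset ι} (hU : U.Nonempty) {S : ι → ℕ → Prop}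
    {al : ℕ → Prop} (hS : ∀ i ∈ U, ∀ c, S i c → al c)
    (h2 : ∀ a b c, al a → al b → al c → a = b ∨ b = c ∨ a = c)
    (hSS : ∀ i ∈ U, ∀ j ∈ U, ∃ c, S i c ∧ S j c) : ∃ c, ∀ i ∈ U, S i c := by
  obtain ⟨i, hi⟩ := hU
  obtain ⟨c₀, h₀, -⟩ := hSS i hi i hi
  by_contra! hcon
  obtain ⟨j, hj, hj'⟩ := hcon c₀
  obtain ⟨c₁, h₁, h₁'⟩ := hSS i hi j hj
  obtain ⟨l, hl, hl'⟩ := hcon c₁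
  obtain ⟨c₂, h₂, h₂'⟩ := hSS j hj l hl
  rcases h2 c₀ c₁ c₂ (hS i hi _ h₀) (hS i hi _ h₁) (hS j hj _ h₂) with rfl | rfl | rfl
  · exact hj' h₁'
  · exact hl' h₂'
  · exact hj' h₂

/-- A path consistent network of variables with at most two values has a solution. -/
theorem exists_solution_of_pathConsistent {U : Finset ℕ} {k : ℕ} {al : ℕ → ℕ → Prop}
    {co P : ℕ → ℕ → ℕ → ℕ → Prop} (hco : ∀ u a b, co u a u b → a = b)
    (hsymm : ∀ u a u' a', co u a u' a' → co u' a' u a)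
    (h1 : ∀ u ∈ U, ∀ u' ∈ U, ∀ a < k, ∀ a' < k, P u a u' a' →
      al u a ∧ al u' a' ∧ co u a u' a')
    (h2 : ∀ u ∈ U, ∀ u' ∈ U, ∀ a < k, ∀ a' < k, P u a u' a' → ∀ w ∈ U,
      ∃ c < k, P u a w c ∧ P u' a' w c)
    (two : ∀ u ∈ U, ∀ a < k, ∀ b < k, ∀ c < k, al u a → al u b → al u c →
      a = b ∨ b = c ∨ a = c)
    (start : ∀ u ∈ U, ∃ a < k, P u a u a) :
    ∃ f : ℕ → ℕ, ∀ u ∈ U, f u < k ∧ al u (f u) ∧ ∀ u' ∈ U, co u (f u) u' (f u') := by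
  -- The variables are assigned one at a time. Since `P` is not assumed to be symmetric, each pair
  -- is only required to be permitted in one of its two orders.
  have key : ∀ V : Finset ℕ, V ⊆ U → ∃ f : ℕ → ℕ, ∀ u ∈ V, f u < k ∧
      ∀ u' ∈ V, P u (f u) u' (f u') ∨ P u' (f u') u (f u) := by
    intro V
    induction V using Finset.induction_on with
    | empty => exact fun _ => ⟨fun _ => 0, by simp⟩
    | insert w V hw ih =>
      intro hVU
      have hwU : w ∈ U := hVU (Finset.mem_insert_self _ _)
      have hVU' : V ⊆ U := (Finset.subset_insert _ _).trans hVU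
      obtain ⟨f, hf⟩ := ih hVU'
      obtain ⟨c, hck, hcc, hc⟩ : ∃ c < k, P w c w c ∧ ∀ u ∈ V, P u (f u) w c := by
        rcases V.eq_empty_or_nonempty with rfl | hV
        · obtain ⟨a, ha, ha'⟩ := start w hwU
          exact ⟨a, ha, ha', by simp⟩
        -- Each assigned variable leaves a set of values for `w`. Path consistency says that any two
        -- of these sets intersect, and all lie in a set with at most two elements, so they have a
        -- common element.
        · obtain ⟨c, hc⟩ := exists_common (S := fun u c => c < k ∧ P u (f u) w c)
            (al := fun c => c < k ∧ al w c) hV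
            (fun u hu c hc => ⟨hc.1, (h1 u (hVU' hu) w hwU _ (hf u hu).1 _ hc.1 hc.2).2.1⟩)
            (fun a b c ha hb hc => two w hwU a ha.1 b hb.1 c hc.1 ha.2 hb.2 hc.2)
            (fun u hu u' hu' => by
              rcases (hf u hu).2 u' hu' with h | h
              · obtain ⟨c, hc, hc1, hc2⟩ :=
                  h2 u (hVU' hu) u' (hVU' hu') _ (hf u hu).1 _ (hf u' hu').1 h w hwU
                exact ⟨c, ⟨hc, hc1⟩, hc, hc2⟩
              · obtain ⟨c, hc, hc1, hc2⟩ :=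
                  h2 u' (hVU' hu') u (hVU' hu) _ (hf u' hu').1 _ (hf u hu).1 h w hwU
                exact ⟨c, ⟨hc, hc2⟩, hc, hc1⟩)
          obtain ⟨u, hu⟩ := hV
          obtain ⟨hck, hcu⟩ := hc u hu
          -- Path consistency with `w` as third variable permits the pair of `(w, c)` and some `(w,
          -- c')`; compatibility then forces `c' = c`.
          obtain ⟨c', hc'k, -, hc'⟩ :=
            h2 u (hVU' hu) w hwU _ (hf u hu).1 _ hck hcu w hwU
          obtain rfl := hco _ _ _ (h1 w hwU w hwU _ hck _ hc'k hc').2.2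
          exact ⟨c, hck, hc', fun u hu => (hc u hu).2⟩
      refine ⟨Function.update f w c, fun u hu => ?_⟩
      have hne : ∀ u ∈ V, Function.update f w c u = f u := fun u hu =>
        Function.update_of_ne (ne_of_mem_of_not_mem hu hw) _ _
      rcases Finset.mem_insert.1 hu with rfl | hu₁
      · refine ⟨by simpa using hck, fun u' hu' => ?_⟩
        rcases Finset.mem_insert.1 hu' with rfl | hu'
        · simpa using hcc
        · rw [hne u' hu', Function.update_self]
          exact Or.inr (hc u' hu')
      · refine ⟨by rw [hne u hu₁]; exact (hf u hu₁).1, fun u' hu' => ?_⟩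
        rcases Finset.mem_insert.1 hu' with rfl | hu'
        · rw [hne u hu₁, Function.update_self]
          exact Or.inl (hc u hu₁)
        · rw [hne u hu₁, hne u' hu']
          exact (hf u hu₁).2 u' hu'
  obtain ⟨f, hf⟩ := key U subset_rfl
  refine ⟨f, fun u hu => ⟨(hf u hu).1, ?_, fun u' hu' => ?_⟩⟩
  · rcases (hf u hu).2 u hu with h | h <;>
      exact (h1 u hu u hu _ (hf u hu).1 _ (hf u hu).1 h).1
  · rcases (hf u hu).2 u' hu' with h | h
    · exact (h1 u hu u' hu' _ (hf u hu).1 _ (hf u' hu').1 h).2.2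
    · exact hsymm _ _ _ _ (h1 u' hu' u hu _ (hf u' hu').1 _ (hf u hu).1 h).2.2

/-! ### The predicates that the program decides -/

section Predicates

variable {k n : ℕ} (H : LoopGraph (Fin k)) (I : Input k n)

/-- The objects `u` and `v` intersect. -/
def Meets (u v : ℕ) : Prop :=
  ∃ (hu : u < n) (hv : v < n), (I.obj ⟨u, hu⟩ ∩ I.obj ⟨v, hv⟩).Nonempty

/-- The colour `a` is on the list of the object `u`. -/
def OnList (u a : ℕ) : Prop := ∃ (hu : u < n) (ha : a < k), (⟨a, ha⟩ : Fin k) ∈ I.list ⟨u, hu⟩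

/-- First coordinate of the centre. -/
def cx (u : ℕ) : ℝ := if h : u < n then I.center ⟨u, h⟩ 0 else 0

/-- Second coordinate of the centre. -/
def cy (u : ℕ) : ℝ := if h : u < n then I.center ⟨u, h⟩ 1 else 0

/-- Radius. -/
def rad (u : ℕ) : ℝ := if h : u < n then I.radius ⟨u, h⟩ else 0

/-- The centre of `w` lies in the square inscribed in the disk of `u`. -/
def Close (u w : ℕ) : Prop :=
  cx I u + cx I u < cx I w + cx I w + rad I u ∧ cx I w + cx I w < cx I u + cx I u + rad I u ∧
  cy I u + cy I u < cy I w + cy I w + rad I u ∧ cy I w + cy I w < cy I u + cy I u + rad I u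

/-- The colours `a` and `b` are adjacent. -/
def ColourAdj (a b : ℕ) : Prop := ∃ (ha : a < k) (hb : b < k), H.Adj ⟨a, ha⟩ ⟨b, hb⟩

/-- Assigning `a` to `u` does not exclude assigning `a'` to `u'`. -/
def Compatible (u a u' a' : ℕ) : Prop :=
  (u = u' → a = a') ∧ (u ≠ u' → Meets I u u' → ColourAdj H a a')

/-- The colour `c` is allowed for `u`, given the partial assignments `E` and `F`, and the set `G`
of colours with which representatives are tagged. -/
def Allowed (E F G : ℕ → ℕ → Prop) (u c : ℕ) : Prop :=
  OnList I u c ∧ ((E u c ∨ F u c) ∨ ((¬ ∃ a < k, E u a ∨ F u a) ∧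
    ∀ w < n, ∀ a < k, Close I u w → G w a → G w c))

/-- The assignments are consistent, and every vertex of `A` has at most two allowed colours. -/
def AtMostTwo (E F G : ℕ → ℕ → Prop) (A : ℕ → Prop) : Prop :=
  (∀ u < n, ∀ a < k, ∀ b < k, (E u a ∨ F u a) → (E u b ∨ F u b) → a = b) ∧
  ∀ u < n, A u → ∀ a < k, ∀ b < k, ∀ c < k, Allowed I E F G u a → Allowed I E F G u b →
    Allowed I E F G u c → a = b ∨ b = c ∨ a = c

/-- The vertices of `A` can be coloured with allowed colours. -/
def Colourable (E F G : ℕ → ℕ → Prop) (A : ℕ → Prop) : Prop :=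
  AtMostTwo I E F G A ∧ ∃ f : ℕ → ℕ, ∀ u < n, A u → f u < k ∧ Allowed I E F G u (f u) ∧
    ∀ u' < n, A u' → Compatible H I u (f u) u' (f u')

/-- The vertex `z` is in the domain of `E`, is `v`, or meets a member of `A` outside of the domain
of `E`. -/
def Forced (E : ℕ → ℕ → Prop) (v : ℕ) (A : ℕ → Prop) (z : ℕ) : Prop :=
  (∃ a < k, E z a) ∨ z = v ∨ ∃ w < n, A w ∧ (¬ ∃ a < k, E w a) ∧ Meets I w z

/-- The vertices in the domain of `E`, `v`, and the vertices that can be reached from it without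
passing through the domain of `E`. -/
def Piece (E : ℕ → ℕ → Prop) (v u : ℕ) : Prop :=
  ∀ A : ℕ → Prop, (∀ z < n, Forced I E v A z → A z) → A u

/-- The pair `(u, a)`, `(u', a')` of assignments has to be excluded, given the excluded pairs. -/
def Excluded (E F G : ℕ → ℕ → Prop) (A : ℕ → Prop) (D : ℕ → ℕ → ℕ → ℕ → Prop)
    (u a u' a' : ℕ) : Prop :=
  A u ∧ A u' ∧ (¬ Allowed I E F G u a ∨ ¬ Allowed I E F G u' a' ∨ ¬ Compatible H I u a u' a' ∨
    ∃ w < n, A w ∧ ∀ c < k, D u a w c ∨ D u' a' w c)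

end Predicates

/-- The set encoded by a guess. -/
def Guess (k C n : ℕ) (X : ℕ → ℕ) (u a : ℕ) : Prop := ∃ j < slots C n, X j = k * u + a

theorem Guess.congr {k C n : ℕ} {X X' : ℕ → ℕ} (h : ∀ j < slots C n, X j = X' j) :
    Guess k C n X = Guess k C n X' := by
  funext u a
  exact propext (exists_congr fun j => and_congr_right fun hj => by rw [h j hj])

/-! ### Decision programs for the atomic predicates and for allowed colours -/

namespace Dec

variable {k C d a : ℕ} {f f' : ℕ → (ℕ → ℕ → ℕ) → ℕ}

theorem meets (hd : 2 ≤ d) (ha : 3 ≤ a) (h : IsTerm k C d a f) (h' : IsTerm k C d a f') :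
    Dec k C d a fun n I g => Meets I (f n g) (f' n g) := by
  obtain ⟨e, he⟩ := h.eval
  obtain ⟨e', he'⟩ := h'.eval
  exact of_test hd ha (fun n _ g g' hg => by rw [h.congr n g g' hg, h'.congr n g g' hg])
    (.intersect e e') fun n I s hs => by simp only [Test.Holds, he n s hs, he' n s hs, Meets]

theorem onList (hd : 2 ≤ d) (ha : 3 ≤ a) (h : IsTerm k C d a f) (h' : IsTerm k C d a f') :
    Dec k C d a fun n I g => OnList I (f n g) (f' n g) := by
  obtain ⟨e, he⟩ := h.eval
  obtain ⟨e', he'⟩ := h'.eval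
  exact of_test hd ha (fun n _ g g' hg => by rw [h.congr n g g' hg, h'.congr n g g' hg])
    (.onList e e') fun n I s hs => by simp only [Test.Holds, he n s hs, he' n s hs, OnList]

theorem close (hd : 2 ≤ d) (ha : 3 ≤ a) (h : IsTerm k C d a f) (h' : IsTerm k C d a f') :
    Dec k C d a fun n I g => Close I (f n g) (f' n g) := by
  obtain ⟨e, he⟩ := h.eval
  obtain ⟨e', he'⟩ := h'.eval
  refine of_test hd ha (fun n _ g g' hg => by rw [h.congr n g g' hg, h'.congr n g g' hg])
    (.and (.realLt (.add (.centerX e) (.centerX e))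
        (.add (.add (.centerX e') (.centerX e')) (.radius e)))
      (.and (.realLt (.add (.centerX e') (.centerX e'))
        (.add (.add (.centerX e) (.centerX e)) (.radius e)))
      (.and (.realLt (.add (.centerY e) (.centerY e))
        (.add (.add (.centerY e') (.centerY e')) (.radius e)))
      (.realLt (.add (.centerY e') (.centerY e'))
        (.add (.add (.centerY e) (.centerY e)) (.radius e))))))
    fun n I s hs => ?_
  simp only [Test.Holds, RExp.val, he n s hs, he' n s hs, Close, cx, cy, rad]

theorem colourAdj (H : LoopGraph (Fin k)) (hd : 2 ≤ d) (ha : 3 ≤ a) (h : IsTerm k C d a f)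
    (h' : IsTerm k C d a f') : Dec k C d a fun n _ g => ColourAdj H (f n g) (f' n g) := by
  refine (exists_mem_list hd ha (fun p : Fin k × Fin k => ((eq hd ha h (.lit p.1)).and
    (eq hd ha h' (.lit p.2))).and (const hd ha (H.Adj p.1 p.2)))
    (Finset.univ : Finset (Fin k × Fin k)).toList).iff fun n I g => ?_
  constructor
  · rintro ⟨h1, h2, h3⟩
    exact ⟨(⟨_, h1⟩, ⟨_, h2⟩), by simp, ⟨rfl, rfl⟩, h3⟩
  · rintro ⟨⟨p, q⟩, -, ⟨h1, h2⟩, h3⟩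
    simp only at h1 h2 h3
    rw [h1, h2]
    exact ⟨p.2, q.2, h3⟩

theorem guess {A : ℕ} (hd : 2 ≤ d) (ha : 3 ≤ a) (hA : 2 ≤ A) (hAa : A < a)
    (h : IsTerm k C d a f) (h' : IsTerm k C d a f') :
    Dec k C d a fun n _ g => Guess k C n (g A) (f n g) (f' n g) :=
  ex (φ := fun n _ g j => g A j = k * f n g + f' n g) hd .slots
    (eq (by omega) ha ((IsTerm.scalar (Nat.lt_succ_self d)).get hA hAa)
      (((h.mono (Nat.le_succ d) le_rfl).smul k).add (h'.mono (Nat.le_succ d) le_rfl)))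
    fun n I g i j => by rw [setScalar_of_ne _ _ _ (by omega), h.setScalar, h'.setScalar]

theorem compatible (H : LoopGraph (Fin k)) {f₁ f₂ f₃ f₄ : ℕ → (ℕ → ℕ → ℕ) → ℕ} (hd : 2 ≤ d)
    (ha : 3 ≤ a) (h₁ : IsTerm k C d a f₁) (h₂ : IsTerm k C d a f₂) (h₃ : IsTerm k C d a f₃)
    (h₄ : IsTerm k C d a f₄) :
    Dec k C d a fun n I g => Compatible H I (f₁ n g) (f₂ n g) (f₃ n g) (f₄ n g) :=
  ((eq hd ha h₁ h₃).imp (eq hd ha h₂ h₄)).and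
    ((ne hd ha h₁ h₃).imp ((meets hd ha h₁ h₃).imp (colourAdj H hd ha h₂ h₄)))

/-- Memory layout from here on: arrays `3`, `5`, `6` hold the guesses `E`, `F`, `G`, array `4` the
vertex set to be coloured, and array `7` the excluded pairs. -/
theorem allowed (hd : 2 ≤ d) (ha : 7 ≤ a) (h : IsTerm k C d a f) (h' : IsTerm k C d a f') :
    Dec k C d a fun n I g => Allowed I (Guess k C n (g 3)) (Guess k C n (g 5))
      (Guess k C n (g 6)) (f n g) (f' n g) := by
  have h1 := h.mono (Nat.le_succ d) le_rfl
  have h2 := h1.mono (Nat.le_succ (d + 1)) le_rfl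
  have h2' := h'.mono (show d ≤ d + 2 by omega) le_rfl
  refine (onList hd (by omega) h h').and
    (((guess hd (by omega) (by omega) (by omega) h h').or
      (guess hd (by omega) (by omega) (by omega) h h')).or ((ex hd (.lit k) (φ := fun n I g j =>
        Guess k C n (g 3) (f n g) j ∨ Guess k C n (g 5) (f n g) j)
      ((guess (by omega) (by omega) (by omega) (by omega) h1 (.scalar (by omega))).or
        (guess (by omega) (by omega) (by omega) (by omega) h1 (.scalar (by omega))))
      ?_).not.and ?_))
  · intro n I g i j
    simp only [h.setScalar, setScalar_of_ne _ _ _ (show 3 ≠ 1 by omega),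
      setScalar_of_ne _ _ _ (show 5 ≠ 1 by omega)]
  · refine all hd .objects (φ := fun n I g w => ∀ a < k, Close I (f n g) w →
      Guess k C n (g 6) w a → Guess k C n (g 6) w (f' n g)) (all (by omega) (.lit k)
      (φ := fun n I g a => Close I (f n g) (g 1 d) →
      Guess k C n (g 6) (g 1 d) a → Guess k C n (g 6) (g 1 d) (f' n g))
      ((close (by omega) (by omega) h2 (.scalar (by omega))).imp
        ((guess (by omega) (by omega) (by omega) (by omega) (.scalar (by omega))
          (.scalar (by omega))).imp
        (guess (by omega) (by omega) (by omega) (by omega) (.scalar (by omega)) h2'))) ?_) ?_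
    · intro n I g i j
      simp only [h1.setScalar, (h'.mono (Nat.le_succ d) le_rfl).setScalar,
        setScalar_of_ne _ _ _ (show 6 ≠ 1 by omega), setScalar_one_ne _ _ (show d ≠ d + 1 by omega)]
    · intro n I g i j
      simp only [h.setScalar, h'.setScalar, setScalar_of_ne _ _ _ (show 6 ≠ 1 by omega)]

end Dec

end

/-! ### Correctness of path consistency, and assembly of the program -/

section

variable {k C : ℕ} (H : LoopGraph (Fin k))

theorem AtMostTwo.congr {n : ℕ} {I : Input k n} {E F G : ℕ → ℕ → Prop} {A A' : ℕ → Prop}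
    (hA : ∀ u < n, A' u → A u) (h : AtMostTwo I E F G A) : AtMostTwo I E F G A' :=
  ⟨h.1, fun u hu hA' => h.2 u hu (hA u hu hA')⟩

theorem Colourable.congr {n : ℕ} {I : Input k n} {E F G : ℕ → ℕ → Prop} {A A' : ℕ → Prop}
    (hA : ∀ u < n, A' u → A u) (h : Colourable H I E F G A) : Colourable H I E F G A' :=
  let ⟨h1, f, hf⟩ := h
  ⟨h1.congr hA, f, fun u hu hu' => ⟨(hf u hu (hA u hu hu')).1, (hf u hu (hA u hu hu')).2.1,
    fun u' hu1 hu2 => (hf u hu (hA u hu hu')).2.2 u' hu1 (hA u' hu1 hu2)⟩⟩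

theorem Meets.symm {n : ℕ} {I : Input k n} {u v : ℕ} (h : Meets I u v) : Meets I v u :=
  let ⟨hu, hv, h⟩ := h
  ⟨hv, hu, by rwa [Set.inter_comm]⟩

theorem ColourAdj.symm {a b : ℕ} (h : ColourAdj H a b) : ColourAdj H b a :=
  let ⟨ha, hb, h⟩ := h
  ⟨hb, ha, H.symm _ _ h⟩

theorem Compatible.symm {n : ℕ} {I : Input k n} {u a u' a' : ℕ} (h : Compatible H I u a u' a') :
    Compatible H I u' a' u a :=
  ⟨fun he => (h.1 he.symm).symm, fun hne hm => (h.2 hne.symm hm.symm).symm⟩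

theorem node_lt {k n u a : ℕ} (hu : u < n) (ha : a < k) : k * u + a < k * n := by
  have : k * (u + 1) ≤ k * n := Nat.mul_le_mul_left _ hu
  rw [mul_add] at this
  omega

theorem node_inj {k u a u' a' : ℕ} (ha : a < k) (ha' : a' < k) (h : k * u + a = k * u' + a') :
    u = u' ∧ a = a' := by
  have hk : 0 < k := by omega
  have h1 : u = u' := by
    have := congrArg (· / k) h
    simpa [Nat.mul_add_div hk, Nat.div_eq_of_lt ha, Nat.div_eq_of_lt ha'] using this
  subst h1
  exact ⟨rfl, by omega⟩

namespace Dec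

theorem atMostTwo {a : ℕ} (ha : 7 ≤ a) : Dec k C 3 a fun n I g => AtMostTwo I (Guess k C n (g 3))
    (Guess k C n (g 5)) (Guess k C n (g 6)) fun u => g 4 u ≠ 0 := by
  have hv : ∀ {d i}, i < d → IsTerm k C d a fun _ g => g 1 i := fun h => .scalar h
  have hg : ∀ {A i j d}, 2 ≤ d → 2 ≤ A → A < a → i < d → j < d →
      Dec k C d a fun n _ g => Guess k C n (g A) (g 1 i) (g 1 j) := fun h1 h2 h3 h4 h5 =>
    guess h1 (by omega) h2 h3 (hv h4) (hv h5)
  have hor : ∀ {i j d}, 2 ≤ d → i < d → j < d →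
      Dec k C d a fun n _ g => Guess k C n (g 3) (g 1 i) (g 1 j) ∨
        Guess k C n (g 5) (g 1 i) (g 1 j) := fun h1 h4 h5 =>
    (hg h1 (by omega) (by omega) h4 h5).or (hg h1 (by omega) (by omega) h4 h5)
  have hal : ∀ {i j d}, 2 ≤ d → i < d → j < d →
      Dec k C d a fun n I g => Allowed I (Guess k C n (g 3)) (Guess k C n (g 5))
        (Guess k C n (g 6)) (g 1 i) (g 1 j) := fun h1 h4 h5 => allowed h1 ha (hv h4) (hv h5)
  refine and ?_ ?_
  · refine all (by omega) .objects (all (by omega) (.lit k) (all (by omega) (.lit k)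
      ((hor ?_ ?_ ?_).imp ((hor ?_ ?_ ?_).imp (eq ?_ ?_ (hv ?_) (hv ?_)))) ?_) ?_) ?_
    any_goals omega
    all_goals exact fun _ _ _ _ _ => Iff.rfl
  · refine all (by omega) .objects (imp (ne ?_ ?_ (.get ?_ ?_ (hv ?_)) (.lit 0))
      (all (by omega) (.lit k) (all (by omega) (.lit k)
      (all (by omega) (.lit k) ((hal ?_ ?_ ?_).imp ((hal ?_ ?_ ?_).imp ((hal ?_ ?_ ?_).imp
        ((eq ?_ ?_ (hv ?_) (hv ?_)).or ((eq ?_ ?_ (hv ?_) (hv ?_)).or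
          (eq ?_ ?_ (hv ?_) (hv ?_))))))) ?_) ?_) ?_)) ?_
    any_goals omega
    all_goals exact fun _ _ _ _ _ => Iff.rfl

/-- Scalars `4` to `7` hold `u`, `a`, `u'`, `a'`. The index of a pair is formed with the table in
array `2`, which replaces a multiplication. -/
theorem excluded : Dec k C 8 8 fun n I g => Excluded H I (Guess k C n (g 3)) (Guess k C n (g 5))
    (Guess k C n (g 6)) (fun u => g 4 u ≠ 0)
    (fun u a u' a' => g 7 (g 2 (k * u + a) + (k * u' + a')) ≠ 0)
    (g 1 4) (g 1 5) (g 1 6) (g 1 7) := by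
  have hv : ∀ {d i}, i < d → IsTerm k C d 8 fun _ g => g 1 i := fun h => .scalar h
  have hA : ∀ {d i}, 2 ≤ d → i < d → Dec k C d 8 fun _ _ g => g 4 (g 1 i) ≠ 0 := fun h1 h2 =>
    ne h1 (by omega) (.get (by omega) (by omega) (hv h2)) (.lit 0)
  have hal : ∀ {i j d}, 2 ≤ d → i < d → j < d →
      Dec k C d 8 fun n I g => Allowed I (Guess k C n (g 3)) (Guess k C n (g 5))
        (Guess k C n (g 6)) (g 1 i) (g 1 j) := fun h1 h4 h5 => allowed h1 (by omega) (hv h4) (hv h5)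
  have hD : ∀ {i j i' j' d}, 2 ≤ d → i < d → j < d → i' < d → j' < d → Dec k C d 8 fun _ _ g =>
      g 7 (g 2 (k * g 1 i + g 1 j) + (k * g 1 i' + g 1 j')) ≠ 0 := fun h1 h2 h3 h4 h5 =>
    ne h1 (by omega) (.get (by omega) (by omega)
      ((IsTerm.get (by omega) (by omega) (((hv h2).smul k).add (hv h3))).add
        (((hv h4).smul k).add (hv h5)))) (.lit 0)
  refine (hA ?_ ?_).and ((hA ?_ ?_).and ((hal ?_ ?_ ?_).not.or ((hal ?_ ?_ ?_).not.or
    ((compatible H ?_ ?_ (hv ?_) (hv ?_) (hv ?_) (hv ?_)).not.or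
    (ex (by omega) .objects ((hA ?_ ?_).and (all (by omega) (.lit k)
      ((hD ?_ ?_ ?_ ?_ ?_).or (hD ?_ ?_ ?_ ?_ ?_)) ?_)) ?_)))))
  any_goals omega
  all_goals exact fun _ _ _ _ _ => Iff.rfl

end Dec

/-- The position of a pair of nodes. -/
def pairIndex (k n u a u' a' : ℕ) : ℕ := (k * u + a) * (k * n) + (k * u' + a')

theorem pairIndex_lt {k n u a u' a' : ℕ} (hu : u < n) (ha : a < k) (hu' : u' < n) (ha' : a' < k) :
    pairIndex k n u a u' a' < (k * n) * (k * n) := by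
  have h1 := node_lt hu ha
  have h2 := node_lt hu' ha'
  rw [pairIndex, mul_comm]
  exact node_lt h1 h2

theorem pairIndex_inj {k n u a u' a' v b v' b' : ℕ} (ha : a < k) (hb : b < k)
    (hu' : u' < n) (ha' : a' < k) (hv' : v' < n) (hb' : b' < k)
    (h : pairIndex k n u a u' a' = pairIndex k n v b v' b') :
    (u = v ∧ a = b) ∧ u' = v' ∧ a' = b' := by
  rw [pairIndex, pairIndex, mul_comm, mul_comm (k * v + b)] at h
  obtain ⟨h1, h2⟩ := node_inj (node_lt hu' ha') (node_lt hv' hb') h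
  exact ⟨node_inj ha hb h1, node_inj ha' hb' h2⟩

/-- Path consistency decides colourability. -/
theorem colourable_iff_of_pathConsistent {n : ℕ} (I : Input k n) (E F G : ℕ → ℕ → Prop)
    (A : ℕ → Prop) (D : ℕ → ℕ)
    (hD : Generated ((k * n) * (k * n)) (fun D z => ∃ u < n, ∃ a < k, ∃ u' < n, ∃ a' < k,
      z = pairIndex k n u a u' a' ∧ Excluded H I E F G A
        (fun u a u' a' => D (pairIndex k n u a u' a') ≠ 0) u a u' a') D)
    (hcl : IsClosedUnder ((k * n) * (k * n)) (fun D z => ∃ u < n, ∃ a < k, ∃ u' < n, ∃ a' < k,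
      z = pairIndex k n u a u' a' ∧ Excluded H I E F G A
        (fun u a u' a' => D (pairIndex k n u a u' a') ≠ 0) u a u' a') D) :
    (AtMostTwo I E F G A ∧ ∀ u < n, A u → ∃ a < k, D (pairIndex k n u a u a) = 0) ↔
      Colourable H I E F G A := by
  classical
  refine and_congr_right fun htwo => ⟨fun hstart => ?_, ?_⟩
  · have hmem : ∀ u, u ∈ (Finset.range n).filter A ↔ u < n ∧ A u := by simp
    have hP : ∀ u < n, ∀ a < k, ∀ u' < n, ∀ a' < k, D (pairIndex k n u a u' a') = 0 →
        ¬ Excluded H I E F G A (fun u a u' a' => D (pairIndex k n u a u' a') ≠ 0) u a u' a' :=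
      fun u hu a ha u' hu' a' ha' h0 hex => hcl _ (pairIndex_lt hu ha hu' ha') h0
        ⟨u, hu, a, ha, u', hu', a', ha', rfl, hex⟩
    obtain ⟨f, hf⟩ := exists_solution_of_pathConsistent (U := (Finset.range n).filter A) (k := k)
      (al := Allowed I E F G) (co := Compatible H I)
      (P := fun u a u' a' => D (pairIndex k n u a u' a') = 0) (fun u a b h => h.1 rfl)
      (fun _ _ _ _ h => h.symm)
      (fun u hu u' hu' a ha a' ha' h0 => by
        rw [hmem] at hu hu'
        have := hP u hu.1 a ha u' hu'.1 a' ha' h0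
        simp only [Excluded, hu.2, hu'.2, true_and] at this
        tauto)
      (fun u hu u' hu' a ha a' ha' h0 w hw => by
        rw [hmem] at hu hu' hw
        have := hP u hu.1 a ha u' hu'.1 a' ha' h0
        simp only [Excluded, hu.2, hu'.2, true_and] at this
        by_contra! hcon
        refine this (Or.inr (Or.inr (Or.inr ⟨w, hw.1, hw.2, fun c hc => ?_⟩)))
        by_contra! h'
        exact hcon c hc h'.1 h'.2)
      (fun u hu => htwo.2 u ((hmem u).1 hu).1 ((hmem u).1 hu).2)
      (fun u hu => hstart u ((hmem u).1 hu).1 ((hmem u).1 hu).2)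
    exact ⟨f, fun u hu hAu => by
      obtain ⟨h1, h2, h3⟩ := hf u ((hmem u).2 ⟨hu, hAu⟩)
      exact ⟨h1, h2, fun u' hu' hAu' => h3 u' ((hmem u').2 ⟨hu', hAu'⟩)⟩⟩
  · rintro ⟨f, hf⟩
    -- No rule ever excludes a pair taken from an actual solution: the pairs of the solution with
    -- the third vertex `w`, coloured `f w`, are still present by induction.
    have key : ∀ u < n, A u → ∀ u' < n, A u' → D (pairIndex k n u (f u) u' (f u')) = 0 := by
      clear hcl
      induction hD with
      | empty D h0 =>
        intro u hu hAu u' hu' hAu'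
        exact h0 _ (pairIndex_lt hu (hf u hu hAu).1 hu' (hf u' hu' hAu').1)
      | insert D z _ hz h0 hex ih =>
        intro u hu hAu u' hu' hAu'
        rw [Function.update_of_ne]
        · exact ih u hu hAu u' hu' hAu'
        · rintro rfl
          obtain ⟨v, hv, b, hb, v', hv', b', hb', he, hex⟩ := hex
          obtain ⟨⟨rfl, rfl⟩, rfl, rfl⟩ := pairIndex_inj (hf u hu hAu).1 hb hu'
            (hf u' hu' hAu').1 hv' hb' he
          rcases hex.2.2 with h | h | h | ⟨w, hw, hAw, h⟩
          · exact h (hf u hu hAu).2.1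
          · exact h (hf u' hu' hAu').2.1
          · exact h ((hf u hu hAu).2.2 u' hu' hAu')
          · rcases h (f w) (hf w hw hAw).1 with h | h
            · exact h (ih u hu hAu w hw hAw)
            · exact h (ih u' hu' hAu' w hw hAw)
    exact fun u hu hAu => ⟨f u, (hf u hu hAu).1, key u hu hAu u hu hAu⟩

/-- The members of a generated closed set. -/
theorem piece_iff {n : ℕ} (I : Input k n) (E : ℕ → ℕ → Prop) (v : ℕ) (A : ℕ → ℕ)
    (hA : Generated n (fun A z => Forced I E v (fun u => A u ≠ 0) z) A)
    (hcl : IsClosedUnder n (fun A z => Forced I E v (fun u => A u ≠ 0) z) A) :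
    ∀ u < n, (A u ≠ 0 ↔ Piece I E v u) := by
  intro u hu
  constructor
  · intro hAu B hB
    suffices ∀ u < n, A u ≠ 0 → B u from this u hu hAu
    clear hcl hAu
    induction hA with
    | empty A h0 => exact fun u hu h => absurd (h0 u hu) h
    | insert A z _ hz h0 hf ih =>
      intro u hu hAu
      rcases eq_or_ne u z with rfl | hne
      · refine hB u hu ?_
        rcases hf with h | h | ⟨w, hw, hAw, h⟩
        · exact Or.inl h
        · exact Or.inr (Or.inl h)
        · exact Or.inr (Or.inr ⟨w, hw, ih w hw hAw, h⟩)
      · rw [Function.update_of_ne hne] at hAu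
        exact ih u hu hAu
  · exact fun h => h (fun u => A u ≠ 0) fun z hz hf h0 => hcl z hz h0 hf

/-- Some assignments `F` and tags `G` make `A` colourable. -/
def Extendable (C : ℕ) {n : ℕ} (I : Input k n) (E : ℕ → ℕ → Prop) (A : ℕ → Prop) : Prop :=
  ∃ F : ℕ → ℕ, (∀ j < slots C n, F j ≤ k * n) ∧ ∃ G : ℕ → ℕ, (∀ j < slots C n, G j ≤ k * n) ∧
    Colourable H I E (Guess k C n F) (Guess k C n G) A

/-- Some partial assignment `E` can be extended to every piece. -/
def Accepts (C : ℕ) {n : ℕ} (I : Input k n) : Prop :=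
  ∃ E : ℕ → ℕ, (∀ j < slots C n, E j ≤ k * n) ∧
    ∀ v < n, Extendable H C I (Guess k C n E) (Piece I (Guess k C n E) v)

namespace Dec

/-- The fixpoint is the set of excluded pairs. As long as the table is intact, the indices computed
by the program are those of `pairIndex`. -/
theorem colourable : Dec k C 3 7 fun n I g => Colourable H I (Guess k C n (g 3))
    (Guess k C n (g 5)) (Guess k C n (g 6)) fun u => g 4 u ≠ 0 := by
  have hv : ∀ {d i}, i < d → IsTerm k C d 8 fun _ g => g 1 i := fun h => .scalar h
  refine fix (b := fun n => (k * n) * (k * n))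
    (ψ := fun n I g D z => ∃ u < n, ∃ a < k, ∃ u' < n, ∃ a' < k,
      z = g 2 (k * u + a) + (k * u' + a') ∧
      Excluded H I (Guess k C n (g 3)) (Guess k C n (g 5)) (Guess k C n (g 6))
        (fun u => g 4 u ≠ 0) (fun u a u' a' => D (g 2 (k * u + a) + (k * u' + a')) ≠ 0) u a u' a')
    (φ := fun n I g D => AtMostTwo I (Guess k C n (g 3))
      (Guess k C n (g 5)) (Guess k C n (g 6)) (fun u => g 4 u ≠ 0) ∧ ∀ u < n, g 4 u ≠ 0 →
        ∃ a < k, D (g 2 (k * u + a) + (k * u + a)) = 0)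
    .pairs ?_ (fun _ _ _ _ _ _ _ => Iff.rfl) ?_ (fun _ _ _ _ _ => Iff.rfl) (by omega) (by omega)
    (fun n I g g' hg => ?_) (fun n I g D hb hD hcl => ?_)
  · refine ex (by omega) .objects (ex (by omega) (.lit k) (ex (by omega) .objects
      (ex (by omega) (.lit k) (and (eq ?_ ?_ (hv ?_) (.add (.get ?_ ?_ (.add (.smul k (hv ?_))
        (hv ?_))) (.add (.smul k (hv ?_)) (hv ?_)))) (excluded H)) ?_) ?_) ?_) ?_
    any_goals omega
    all_goals exact fun _ _ _ _ _ => Iff.rfl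
  · refine (atMostTwo (by omega)).and (all (by omega) .objects (imp (ne ?_ ?_
      (.get ?_ ?_ (hv ?_)) (.lit 0)) (ex (by omega) (.lit k) (eq ?_ ?_ (.get ?_ ?_
        (.add (.get ?_ ?_ (.add (.smul k (hv ?_)) (hv ?_))) (.add (.smul k (hv ?_)) (hv ?_))))
        (.lit 0)) ?_)) ?_)
    any_goals omega
    all_goals exact fun _ _ _ _ _ => Iff.rfl
  · simp only [hg.2 3 (by omega) (by omega), hg.2 4 (by omega) (by omega),
      hg.2 5 (by omega) (by omega), hg.2 6 (by omega) (by omega)]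
  · have htab : ∀ u < n, ∀ a < k, ∀ u' a',
        g 2 (k * u + a) + (k * u' + a') = pairIndex k n u a u' a' := fun u hu a ha u' a' => by
      rw [hb.table _ (node_lt hu ha), pairIndex]
    have hψ : ∀ (D : ℕ → ℕ) z, (∃ u < n, ∃ a < k, ∃ u' < n, ∃ a' < k,
      z = g 2 (k * u + a) + (k * u' + a') ∧
      Excluded H I (Guess k C n (g 3)) (Guess k C n (g 5)) (Guess k C n (g 6))
        (fun u => g 4 u ≠ 0) (fun u a u' a' => D (g 2 (k * u + a) + (k * u' + a')) ≠ 0)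
          u a u' a') ↔ ∃ u < n, ∃ a < k, ∃ u' < n, ∃ a' < k,
      z = pairIndex k n u a u' a' ∧
      Excluded H I (Guess k C n (g 3)) (Guess k C n (g 5)) (Guess k C n (g 6))
        (fun u => g 4 u ≠ 0) (fun u a u' a' => D (pairIndex k n u a u' a') ≠ 0) u a u' a' := by
      intro D z
      refine exists_congr fun u => and_congr_right fun hu => exists_congr fun a =>
        and_congr_right fun ha => exists_congr fun u' => and_congr_right fun hu' =>
        exists_congr fun a' => and_congr_right fun ha' => ?_
      rw [htab u hu a ha]
      refine and_congr_right fun _ => ?_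
      simp only [Excluded, htab u hu a ha, htab u' hu' a' ha']
    rw [← colourable_iff_of_pathConsistent H I _ _ _ _ D
      (by simpa only [hψ] using hD) (by simpa only [hψ] using hcl)]
    refine and_congr_right fun _ => forall_congr' fun u => imp_congr_right fun hu =>
      imp_congr_right fun _ => exists_congr fun a => and_congr_right fun ha => ?_
    rw [htab u hu a ha]

theorem extendable : Dec k C 3 5 fun n I g =>
    Extendable H C I (Guess k C n (g 3)) fun u => g 4 u ≠ 0 := by
  refine search (by omega) (by omega) (search (by omega) (by omega) (colourable H)
    (fun _ _ _ _ _ => Iff.rfl) ?_) (fun _ _ _ _ _ => Iff.rfl) ?_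
  · exact fun n I g X X' h => by rw [Guess.congr h]; exact id
  · exact fun n I g X X' h => by rw [Guess.congr h]; exact id

/-- The piece of the vertex in scalar `2` is computed as a fixpoint into array `4`, and takes the
place of the arbitrary vertex set in `Dec.extendable`. -/
theorem extendable_piece : Dec k C 3 4 fun n I g =>
    Extendable H C I (Guess k C n (g 3)) (Piece I (Guess k C n (g 3)) (g 1 2)) := by
  have hv : ∀ {d i}, i < d → IsTerm k C d 5 fun _ g => g 1 i := fun h => .scalar h
  refine fix (ψ := fun n I g A z => Forced I (Guess k C n (g 3)) (g 1 2) (fun u => A u ≠ 0) z)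
    (φ := fun n I g A => Extendable H C I (Guess k C n (g 3)) fun u => A u ≠ 0) .objects
    ?_ (fun _ _ _ _ _ _ _ => Iff.rfl) (extendable H) (fun _ _ _ _ _ => Iff.rfl) (by omega)
    (by omega) (fun n I g g' hg => ?_) (fun n I g A hb hA hcl => ?_)
  · refine (ex ?_ (.lit k) (guess ?_ ?_ ?_ ?_ (hv ?_) (hv ?_)) ?_).or
      ((eq ?_ ?_ (hv ?_) (hv ?_)).or (ex ?_ .objects ((ne ?_ ?_ (.get ?_ ?_ (hv ?_)) (.lit 0)).and
        ((ex ?_ (.lit k) (guess ?_ ?_ ?_ ?_ (hv ?_) (hv ?_)) ?_).not.and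
          (meets ?_ ?_ (hv ?_) (hv ?_)))) ?_))
    any_goals omega
    all_goals exact fun _ _ _ _ _ => Iff.rfl
  · simp only [hg.2 3 (by omega) (by omega), hg.1 2 (by omega)]
  · have := piece_iff I _ _ A hA hcl
    constructor
    · rintro ⟨F, hF, G, hG, h⟩
      exact ⟨F, hF, G, hG, h.congr H fun u hu h' => (this u hu).2 h'⟩
    · rintro ⟨F, hF, G, hG, h⟩
      exact ⟨F, hF, G, hG, h.congr H fun u hu h' => (this u hu).1 h'⟩

/-- Only `E` is shared by the pieces. The guesses `F` and `G` are made for each `v` anew, so their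
costs add up over the pieces instead of multiplying. -/
theorem accepts : Dec k C 2 3 fun _ I _ => Accepts H C I := by
  refine search (φ := fun n I _ X => ∀ v < n, Extendable H C I (Guess k C n X)
      (Piece I (Guess k C n X) v)) (by omega) (by omega) (all (by omega) .objects
      (extendable_piece H) (fun _ _ _ _ _ => Iff.rfl)) (fun _ _ _ _ _ => Iff.rfl) ?_
  exact fun n I g X X' h => by rw [Guess.congr h]; exact id

end Dec

/-- The program. -/
theorem exists_program (C : ℕ) : ∃ (P : Prog) (t : ℕ → ℕ), Subexp t ∧
    ∀ n (I : Input k n), ∃ (out : Memory) (τ : ℕ), Exec I P Memory.init out τ ∧ τ ≤ t n ∧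
      out.nat 0 0 = ind (Accepts H C I) := by
  obtain ⟨p, t, ht, hp⟩ := exists_setup k C
  obtain ⟨p', t', ht', hp'⟩ := (Dec.accepts (C := C) H).run
  exact ⟨.seq p p', _, ht.add ht', fun n I => Runs.seq ((hp n I).mono le_rfl fun s hs =>
    (hp' n I s hs).mono le_rfl fun s' h => h.2)⟩

end

section

variable {k n : ℕ} {H : LoopGraph (Fin k)} {I : Input k n}

/-- A list homomorphism, as a function on natural numbers. -/
def IsColouring (H : LoopGraph (Fin k)) (I : Input k n) (f : ℕ → ℕ) : Prop :=
  (∀ u < n, f u < k ∧ OnList I u (f u)) ∧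
    ∀ u < n, ∀ v < n, u ≠ v → Meets I u v → ColourAdj H (f u) (f v)

theorem isYes_iff : I.IsYes H ↔ ∃ f, IsColouring H I f := by
  constructor
  · rintro ⟨f, hf, hl⟩
    have hval : ∀ u (hu : u < n), (if h : u < n then (f ⟨u, h⟩ : ℕ) else 0) = f ⟨u, hu⟩ :=
      fun u hu => dif_pos hu
    refine ⟨fun u => if h : u < n then f ⟨u, h⟩ else 0, fun u hu => ?_, fun u hu v hv hne hm => ?_⟩
    · simp only [hval u hu]
      exact ⟨(f ⟨u, hu⟩).2, hu, (f ⟨u, hu⟩).2, hl _⟩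
    · simp only [hval u hu, hval v hv]
      exact ⟨(f ⟨u, hu⟩).2, (f ⟨v, hv⟩).2,
        hf _ _ ⟨fun h => hne (congrArg Fin.val h), hm.2.2⟩⟩
  · rintro ⟨f, hf, hadj⟩
    refine ⟨fun u => ⟨f u, (hf u u.2).1⟩, fun u v huv => ?_, fun u => ?_⟩
    · exact (hadj u u.2 v v.2 (fun h => huv.1 (Fin.ext h)) ⟨u.2, v.2, huv.2⟩).2.2
    · exact (hf u u.2).2.2.2

/-! ### Soundness -/

/-- A piece is the intersection of all closed sets, and forcing is monotone; hence the intersection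
is closed too. -/
theorem Piece.of_forced {E : ℕ → ℕ → Prop} {v z : ℕ} (hz : z < n)
    (h : Forced I E v (Piece I E v) z) : Piece I E v z := by
  intro A hA
  refine hA z hz ?_
  rcases h with h | h | ⟨w, hw, hp, h⟩
  · exact Or.inl h
  · exact Or.inr (Or.inl h)
  · exact Or.inr (Or.inr ⟨w, hw, hp A hA, h⟩)

/-- The colourings of the pieces are glued. They agree on the domain of `E`, where the consistency
part of `AtMostTwo` forces the value prescribed by `E`; and two vertices outside of it that meet
belong to the same pieces. -/
theorem exists_colouring_of_accepts {C : ℕ} (h : Accepts H C I) : ∃ f, IsColouring H I f := by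
  classical
  obtain ⟨E₀, -, h⟩ := h
  set E := Guess k C n E₀
  have h' : ∀ v, ∃ f : ℕ → ℕ, v < n → (∀ u < n, Piece I E v u → f u < k ∧ OnList I u (f u) ∧
      ((∃ a < k, E u a) → ∀ a < k, E u a → f u = a) ∧
      ∀ u' < n, Piece I E v u' → Compatible H I u (f u) u' (f u')) := by
    intro v
    by_cases hv : v < n
    · obtain ⟨F, -, G, -, htwo, f, hf⟩ := h v hv
      refine ⟨f, fun _ u hu hp => ⟨(hf u hu hp).1, (hf u hu hp).2.1.1, fun hE a ha hEa => ?_,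
        (hf u hu hp).2.2⟩⟩
      rcases (hf u hu hp).2.1.2 with hX | ⟨hX, -⟩
      · exact htwo.1 u hu _ (hf u hu hp).1 a ha hX (Or.inl hEa)
      · exact absurd ⟨a, ha, Or.inl hEa⟩ hX
    · exact ⟨fun _ => 0, fun h => absurd h hv⟩
  choose g hg using h'
  -- Each vertex takes its colour from the piece with the least starting vertex among those that
  -- contain it. Vertices with the same set of pieces thus use the same colouring.
  let S : ℕ → Set ℕ := fun u => {v | v < n ∧ Piece I E v u}
  have hmem : ∀ u < n, sInf (S u) ∈ S u := fun u hu =>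
    Nat.sInf_mem ⟨u, hu, Piece.of_forced hu (Or.inr (Or.inl rfl))⟩
  have hdom : ∀ u < n, (∃ a < k, E u a) → ∀ v < n, Piece I E v u := fun u hu hE v _ =>
    Piece.of_forced hu (Or.inl hE)
  have hsame : ∀ u < n, (∃ a < k, E u a) → ∀ v < n, ∀ v' < n, g v u = g v' u := by
    intro u hu hE v hv v' hv'
    obtain ⟨a, ha, hEa⟩ := hE
    rw [(hg v hv u hu (hdom u hu ⟨a, ha, hEa⟩ v hv)).2.2.1 ⟨a, ha, hEa⟩ a ha hEa,
      (hg v' hv' u hu (hdom u hu ⟨a, ha, hEa⟩ v' hv')).2.2.1 ⟨a, ha, hEa⟩ a ha hEa]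
  refine ⟨fun u => g (sInf (S u)) u, fun u hu => ?_, fun u hu u' hu' hne hm => ?_⟩
  · have := hg _ (hmem u hu).1 u hu (hmem u hu).2
    exact ⟨this.1, this.2.1⟩
  · by_cases hE : ∃ a < k, E u a
    · have h1 := hg _ (hmem u' hu').1 u hu (hdom u hu hE _ (hmem u' hu').1)
      have h2 := h1.2.2.2 u' hu' (hmem u' hu').2
      simp only [hsame u hu hE _ (hmem u hu).1 _ (hmem u' hu').1]
      exact h2.2 hne hm
    by_cases hE' : ∃ a < k, E u' a
    · have h1 := hg _ (hmem u hu).1 u hu (hmem u hu).2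
      have h2 := h1.2.2.2 u' hu' (hdom u' hu' hE' _ (hmem u hu).1)
      simp only [hsame u' hu' hE' _ (hmem u' hu').1 _ (hmem u hu).1]
      exact h2.2 hne hm
    · have hS : S u = S u' := by
        ext v
        refine and_congr_right fun hv => ⟨fun hp => ?_, fun hp => ?_⟩
        · exact Piece.of_forced hu' (Or.inr (Or.inr ⟨u, hu, hp, hE, hm⟩))
        · exact Piece.of_forced hu (Or.inr (Or.inr ⟨u', hu', hp, hE', hm.symm⟩))
      have h1 := hg _ (hmem u hu).1 u hu (hmem u hu).2
      have h2 := h1.2.2.2 u' hu' (by rw [hS]; exact (hmem u' hu').2)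
      simp only [← hS]
      exact h2.2 hne hm

/-! ### Completeness -/

/-- A small set of nodes is encoded by a guess. -/
theorem exists_guess {C : ℕ} (s : Finset (ℕ × ℕ)) (hs : ∀ p ∈ s, p.1 < n ∧ p.2 < k)
    (hcard : s.card ≤ slots C n) : ∃ X : ℕ → ℕ, (∀ j < slots C n, X j ≤ k * n) ∧
      ∀ u < n, ∀ a < k, (Guess k C n X u a ↔ (u, a) ∈ s) := by
  classical
  let e := s.equivFin.symm
  let X : ℕ → ℕ := fun j => if h : j < s.card then k * (e ⟨j, h⟩).1.1 + (e ⟨j, h⟩).1.2 else k * n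
  refine ⟨X, fun j _ => ?_, fun u hu a ha => ⟨?_, fun hua => ?_⟩⟩
  · by_cases h : j < s.card
    · have := hs _ (e ⟨j, h⟩).2
      simp only [X, dif_pos h]
      exact (node_lt this.1 this.2).le
    · simp [X, h]
  · rintro ⟨j, -, hj⟩
    by_cases h : j < s.card
    · have h' := (e ⟨j, h⟩).2
      have := hs _ h'
      simp only [X, dif_pos h] at hj
      obtain ⟨rfl, rfl⟩ := node_inj this.2 ha hj
      exact h'
    · simp only [X, dif_neg h] at hj
      have := node_lt hu ha
      omega
  · have hlt := (s.equivFin ⟨(u, a), hua⟩).2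
    refine ⟨s.equivFin ⟨(u, a), hua⟩, by omega, ?_⟩
    simp [X, e]

theorem succ_ediv_of_not_dvd {m x : ℤ} (hm : 0 < m) (h : ¬ m ∣ x + 1) : (x + 1) / m = x / m := by
  have h1 := Int.emod_add_mul_ediv x m
  have h2 := Int.emod_nonneg x hm.ne'
  have h3 := Int.emod_lt_of_pos x hm
  have h4 : x % m + 1 ≠ m := by
    intro h5
    refine h ⟨1 + x / m, ?_⟩
    linear_combination -h1 + h5
  have h6 : x + 1 = (x % m + 1) + m * (x / m) := by linarith
  rw [h6, Int.add_mul_ediv_left _ _ hm.ne', Int.ediv_eq_zero_of_lt (by omega) (by omega), zero_add]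

/-- Neighbouring integers outside of the class of `a` lie in the same block. -/
theorem block_eq {m a x y : ℤ} (hm : 0 < m) (hx : ¬ x % m = a % m) (hy : ¬ y % m = a % m)
    (h : |x - y| ≤ 1) : (x - a) / m = (y - a) / m := by
  rw [Int.emod_eq_emod_iff_emod_sub_eq_zero, ← Int.dvd_iff_emod_eq_zero] at hx hy
  rw [abs_le] at h
  obtain h | h | h : x = y ∨ x = y + 1 ∨ y = x + 1 := by omega
  · rw [h]
  · have h1 : x - a = y - a + 1 := by omega
    rw [h1] at hx ⊢
    exact succ_ediv_of_not_dvd hm hx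
  · have h1 : y - a = x - a + 1 := by omega
    rw [h1] at hy ⊢
    exact (succ_ediv_of_not_dvd hm hy).symm

/-- Strips of width `D` turn bounded distance between cells into equality or adjacency of strips, so
that deleting a single strip separates its two sides. -/
theorem abs_ediv_sub_le {D x y : ℤ} (hD : 0 < D) (h : |x - y| ≤ D) : |x / D - y / D| ≤ 1 := by
  have key : ∀ x y : ℤ, x - y ≤ D → x / D ≤ y / D + 1 := fun x y h => by
    rw [← Int.add_mul_ediv_left y 1 hD.ne', mul_one]
    exact Int.ediv_le_ediv hD (by linarith)
  rw [abs_le] at h ⊢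
  have h1 := key x y h.2
  have h2 := key y x (by linarith [h.1])
  constructor <;> linarith

/-- A block extends over `D * m` consecutive cell indices in each direction, which bounds its number
of cells by `(D * m) ^ 2`. -/
theorem mem_Ico_of_block {D m a x B : ℤ} (hD : 0 < D) (hm : 0 < m) (h : (x / D - a) / m = B) :
    x ∈ Finset.Ico (D * (m * B + a)) (D * (m * B + a) + D * m) := by
  have h1 := Int.mul_ediv_self_le (x := x / D - a) hm.ne'
  have h2 := Int.lt_mul_ediv_self_add (x := x / D - a) hm
  have h3 := Int.mul_ediv_self_le (x := x) hD.ne'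
  have h4 := Int.lt_mul_ediv_self_add (x := x) hD
  rw [h] at h1 h2
  rw [Finset.mem_Ico]
  constructor
  · have : D * (m * B + a) ≤ D * (x / D) := mul_le_mul_of_nonneg_left (by linarith) hD.le
    linarith
  · have : D * (x / D + 1) ≤ D * (m * B + a + m) := mul_le_mul_of_nonneg_left (by linarith) hD.le
    linarith

/-- Averaging: at most `m ^ 3` objects are distributed over `m` residue classes. -/
theorem exists_residue {m : ℕ} (hm : 0 < m) (hn : n ≤ m ^ 3) (J : ℕ → ℤ) :
    ∃ a : ℤ, ((Finset.range n).filter fun u => J u % m = a % m).card ≤ m ^ 2 := by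
  obtain ⟨a, ha, h⟩ := Finset.exists_card_fiber_le_of_card_le_mul (s := Finset.range n)
    (t := Finset.Ico (0 : ℤ) m) (f := fun u => J u % m) (n := m ^ 2) ⟨0, by simpa using hm⟩
    (by simp only [Finset.card_range, Int.card_Ico, sub_zero, Int.toNat_natCast]; linarith [hn])
  rw [Finset.mem_Ico] at ha
  exact ⟨a, by rwa [Int.emod_eq_of_lt ha.1 ha.2]⟩

theorem eq_of_mrc_le_two (hH : H.mrc ≤ 2) {a b c : ℕ} (haa : ColourAdj H a a)
    (hbb : ColourAdj H b b) (hcc : ColourAdj H c c) (hab : ColourAdj H a b)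
    (hbc : ColourAdj H b c) (hac : ColourAdj H a c) : a = b ∨ b = c ∨ a = c := by
  classical
  by_contra! hne
  obtain ⟨ha, _, haa⟩ := haa
  obtain ⟨hb, _, hbb⟩ := hbb
  obtain ⟨hc, _, hcc⟩ := hcc
  have hclique : H.IsReflexiveClique {⟨a, ha⟩, ⟨b, hb⟩, ⟨c, hc⟩} := by
    intro x hx y hy
    simp only [Finset.mem_insert, Finset.mem_singleton] at hx hy
    rcases hx with rfl | rfl | rfl <;> rcases hy with rfl | rfl | rfl
    exacts [haa, hab.2.2, hac.2.2, H.symm _ _ hab.2.2, hbb, hbc.2.2, H.symm _ _ hac.2.2,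
      H.symm _ _ hbc.2.2, hcc]
  have hcard : ({⟨a, ha⟩, ⟨b, hb⟩, ⟨c, hc⟩} : Finset (Fin k)).card = 3 :=
    Finset.card_eq_three.2 ⟨_, _, _, by simpa using hne.1, by simpa using hne.2.2,
      by simpa using hne.2.1, rfl⟩
  have : 3 ≤ H.mrc := by
    rw [← hcard]
    unfold LoopGraph.mrc
    refine Finset.le_sup (f := Finset.card) (Finset.mem_filter.2 ⟨Finset.mem_univ _, hclique⟩)
  omega

/-- The number of pairs of a cell of a block and a colour. -/
theorem card_product_le {x y : ℤ} {D m : ℕ} :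
    (Finset.Ico x (x + D * m) ×ˢ Finset.Ico y (y + D * m) ×ˢ Finset.range k).card =
      D ^ 2 * k * m ^ 2 := by
  have : ((D : ℤ) * m).toNat = D * m := by rw [← Nat.cast_mul]; exact Int.toNat_natCast _
  simp only [Finset.card_product, Int.card_Ico, add_sub_cancel_left, this, Finset.card_range]
  ring

/-- If the objects can be assigned to cells such that objects of the same cell are close to each
other and objects that meet are in cells of bounded distance, then every colouring is found. -/
theorem accepts_of_colouring (hH : H.mrc ≤ 2) {D : ℕ} (hD : 0 < D) (ix iy : ℕ → ℤ)
    (hcell : ∀ u < n, ∀ w < n, ix u = ix w → iy u = iy w → Close I u w)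
    (hix : ∀ u w, Meets I u w → |ix u - ix w| ≤ D) (hiy : ∀ u w, Meets I u w → |iy u - iy w| ≤ D)
    (hclose : ∀ u < n, ∀ v < n, ∀ w < n, Close I u w → Close I v w → Meets I u v)
    {f : ℕ → ℕ} (hf : IsColouring H I f) : Accepts H (2 + D ^ 2 * k) I := by
  classical
  rcases n.eq_zero_or_pos with rfl | hn
  · exact ⟨fun _ => 0, by simp, by simp⟩
  set C := 2 + D ^ 2 * k with hC
  set m := cubeRoot n with hm
  have hnm : n ≤ m ^ 3 := le_cubeRoot n
  have hmpos : 0 < m := by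
    rcases m.eq_zero_or_pos with h | h
    · rw [h] at hnm; omega
    · exact h
  have hslots : slots C n = C * m ^ 2 := rfl
  obtain ⟨a, ha⟩ := exists_residue hmpos hnm fun u => ix u / D
  obtain ⟨b, hb⟩ := exists_residue hmpos hnm fun u => iy u / D
  have hDz : (0 : ℤ) < D := by exact_mod_cast hD
  have hmz : (0 : ℤ) < m := by exact_mod_cast hmpos
  -- The separator consists of the objects in the deleted strips. It has at most `2 * m ^ 2`
  -- members, whence the summand `2` in the number of slots.
  let S : ℕ → Prop := fun u => ix u / D % m = a % m ∨ iy u / D % m = b % m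
  let blockX : ℕ → ℤ := fun u => (ix u / D - a) / m
  let blockY : ℕ → ℤ := fun u => (iy u / D - b) / m
  have hblock : ∀ u w, ¬ S u → ¬ S w → Meets I u w → blockX u = blockX w ∧ blockY u = blockY w := by
    intro u w hu hw huw
    simp only [S, not_or] at hu hw
    exact ⟨block_eq hmz hu.1 hw.1 (abs_ediv_sub_le hDz (hix u w huw)),
      block_eq hmz hu.2 hw.2 (abs_ediv_sub_le hDz (hiy u w huw))⟩
  obtain ⟨E₀, hE₀, hE⟩ := exists_guess (k := k) (n := n) (C := C)
    (((Finset.range n).filter S).image fun u => (u, f u))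
    (fun p hp => by
      obtain ⟨u, hu, rfl⟩ := Finset.mem_image.1 hp
      have hu := Finset.mem_range.1 (Finset.mem_filter.1 hu).1
      exact ⟨hu, (hf.1 u hu).1⟩)
    (by
      refine Finset.card_image_le.trans ?_
      rw [Finset.filter_or]
      refine (Finset.card_union_le _ _).trans ?_
      rw [hslots, hC]
      nlinarith [ha, hb, Nat.zero_le (D ^ 2 * k * m ^ 2)])
  have hE' : ∀ u < n, ∀ c < k, (Guess k C n E₀ u c ↔ S u ∧ c = f u) := by
    intro u hu c hc
    rw [hE u hu c hc, Finset.mem_image]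
    simp only [Finset.mem_filter, Finset.mem_range, Prod.mk.injEq]
    constructor
    · rintro ⟨u, ⟨-, h1⟩, rfl, rfl⟩
      exact ⟨h1, rfl⟩
    · rintro ⟨h1, rfl⟩
      exact ⟨u, ⟨hu, h1⟩, rfl, rfl⟩
  have hdom : ∀ u < n, ((∃ c < k, Guess k C n E₀ u c) ↔ S u) := by
    intro u hu
    constructor
    · rintro ⟨c, hc, h⟩
      exact ((hE' u hu c hc).1 h).1
    · intro h
      exact ⟨f u, (hf.1 u hu).1, (hE' u hu _ (hf.1 u hu).1).2 ⟨h, rfl⟩⟩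
  refine ⟨E₀, hE₀, fun v hv => ?_⟩
  -- The separator together with the block of `v` is closed under forcing, so it contains the piece
  -- of `v`.
  have hpiece : ∀ u < n, Piece I (Guess k C n E₀) v u → S u ∨ (blockX u = blockX v ∧ blockY u =
      blockY v) := by
    intro u hu hp
    refine hp (fun u => S u ∨ (blockX u = blockX v ∧ blockY u = blockY v)) fun z hz hforced => ?_
    by_cases hSz : S z
    · exact Or.inl hSz
    rcases hforced with h | rfl | ⟨w, hw, hAw, hdw, hwz⟩
    · exact Or.inl ((hdom z hz).1 h)
    · exact Or.inr ⟨rfl, rfl⟩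
    · rw [hdom w hw] at hdw
      have h1 := hblock w z hdw hSz hwz
      have h2 := hAw.resolve_left hdw
      exact Or.inr ⟨h1.1 ▸ h2.1, h1.2 ▸ h2.2⟩
  let cells := Finset.Ico (D * (m * blockX v + a)) (D * (m * blockX v + a) + D * m) ×ˢ
    Finset.Ico (D * (m * blockY v + b)) (D * (m * blockY v + b) + D * m) ×ˢ Finset.range k
  have hcells : cells.card ≤ slots C n := by
    have : cells.card = D ^ 2 * k * m ^ 2 := card_product_le
    rw [this, hslots, hC]
    exact Nat.mul_le_mul_right _ (Nat.le_add_left _ _)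
  have hmem : ∀ u, blockX u = blockX v → blockY u = blockY v → ∀ c < k, (ix u, iy u, c) ∈ cells :=
      by
    intro u h1 h2 c hc
    simp only [cells, Finset.mem_product]
    exact ⟨mem_Ico_of_block hDz hmz h1, mem_Ico_of_block hDz hmz h2, Finset.mem_range.2 hc⟩
  -- Two objects of one cell meet, so if they share a colour, that colour has a loop. Hence cell and
  -- colour determine an object with a loopless colour, and there are at most `D ^ 2 * k * m ^ 2` of
  -- them in the block.
  obtain ⟨F₀, hF₀, hF⟩ := exists_guess (k := k) (n := n) (C := C)
    (((Finset.range n).filter fun u => (blockX u = blockX v ∧ blockY u = blockY v) ∧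
      ¬ ColourAdj H (f u) (f u)).image fun u => (u, f u))
    (fun p hp => by
      obtain ⟨u, hu, rfl⟩ := Finset.mem_image.1 hp
      have hu := Finset.mem_range.1 (Finset.mem_filter.1 hu).1
      exact ⟨hu, (hf.1 u hu).1⟩)
    (by
      refine Finset.card_image_le.trans (le_trans ?_ hcells)
      refine Finset.card_le_card_of_injOn (fun u => (ix u, iy u, f u)) (fun u hu => ?_) ?_
      · have hu := Finset.mem_filter.1 hu
        exact hmem u hu.2.1.1 hu.2.1.2 _ (hf.1 u (Finset.mem_range.1 hu.1)).1
      · intro u hu w hw huw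
        have hu := Finset.mem_filter.1 hu
        have hw := Finset.mem_filter.1 hw
        have hun := Finset.mem_range.1 hu.1
        have hwn := Finset.mem_range.1 hw.1
        simp only [Prod.mk.injEq] at huw
        by_contra hne
        have h1 := hclose u hun w hwn w hwn (hcell u hun w hwn huw.1 huw.2.1)
          (hcell w hwn w hwn rfl rfl)
        have h2 := hf.2 u hun w hwn hne h1
        rw [← huw.2.2] at h2
        exact hu.2.2 h2)
  have hF' : ∀ u < n, ∀ c < k, (Guess k C n F₀ u c ↔
      ((blockX u = blockX v ∧ blockY u = blockY v) ∧ ¬ ColourAdj H (f u) (f u)) ∧ c = f u) := by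
    intro u hu c hc
    rw [hF u hu c hc, Finset.mem_image]
    simp only [Finset.mem_filter, Finset.mem_range, Prod.mk.injEq]
    constructor
    · rintro ⟨u, ⟨-, h1⟩, rfl, rfl⟩
      exact ⟨h1, rfl⟩
    · rintro ⟨h1, rfl⟩
      exact ⟨u, ⟨hu, h1⟩, rfl, rfl⟩
  -- All objects close to `w` contain the centre of `w`, so the tags of `w` form a reflexive clique.
  -- Tags depend only on the object `w`, not on a cell, since the program can test closeness but
  -- does not know the cells.
  let tag : ℕ → ℕ → Prop := fun w c => ColourAdj H c c ∧ ∃ u < n, Close I u w ∧ f u = c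
  have htag : ∀ w < n, ∀ c c', tag w c → tag w c' → ColourAdj H c c' := by
    rintro w hw c c' ⟨hc, u, hu, hu1, rfl⟩ ⟨-, u', hu', hu1', rfl⟩
    rcases eq_or_ne u u' with rfl | hne
    · exact hc
    · exact hf.2 u hu u' hu' hne (hclose u hu u' hu' w hw hu1 hu1')
  -- An empty cell gets the default `sInf ∅ = 0` as representative. This is harmless: object `0`
  -- then receives tags that are correct for it.
  let rep : ℤ → ℤ → ℕ := fun x y => sInf {u | u < n ∧ ix u = x ∧ iy u = y}
  have hrep : ∀ u < n, rep (ix u) (iy u) < n ∧ ix (rep (ix u) (iy u)) = ix u ∧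
      iy (rep (ix u) (iy u)) = iy u := fun u hu =>
    Nat.sInf_mem (s := {w | w < n ∧ ix w = ix u ∧ iy w = iy u}) ⟨u, hu, rfl, rfl⟩
  obtain ⟨G₀, hG₀, hG⟩ := exists_guess (k := k) (n := n) (C := C)
    ((cells.filter fun p => rep p.1 p.2.1 < n ∧ tag (rep p.1 p.2.1) p.2.2).image
      fun p => (rep p.1 p.2.1, p.2.2))
    (fun q hq => by
      obtain ⟨p, hp, rfl⟩ := Finset.mem_image.1 hq
      have hp := Finset.mem_filter.1 hp
      exact ⟨hp.2.1, Finset.mem_range.1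
        (Finset.mem_product.1 (Finset.mem_product.1 hp.1).2).2⟩)
    (Finset.card_image_le.trans ((Finset.card_filter_le _ _).trans hcells))
  -- Tag sets are recorded completely or not at all. Completeness keeps the true colour of every
  -- object close to a tagged `w` allowed.
  have hG1 : ∀ w < n, ∀ c < k, Guess k C n G₀ w c → tag w c ∧
      ∀ c' < k, tag w c' → Guess k C n G₀ w c' := by
    intro w hw c hc h
    rw [hG w hw c hc, Finset.mem_image] at h
    obtain ⟨⟨x, y, c₁⟩, hp, he⟩ := h
    simp only [Prod.mk.injEq] at he
    obtain ⟨rfl, rfl⟩ := he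
    have hp := Finset.mem_filter.1 hp
    refine ⟨hp.2.2, fun c' hc' h' => ?_⟩
    rw [hG _ hw c' hc', Finset.mem_image]
    refine ⟨(x, y, c'), Finset.mem_filter.2 ⟨?_, hw, h'⟩, rfl⟩
    have h1 := Finset.mem_product.1 hp.1
    exact Finset.mem_product.2 ⟨h1.1, Finset.mem_product.2
      ⟨(Finset.mem_product.1 h1.2).1, Finset.mem_range.2 hc'⟩⟩
  have hG2 : ∀ u < n, blockX u = blockX v → blockY u = blockY v → ∀ c < k, tag (rep (ix u) (iy u))
      c →
      Guess k C n G₀ (rep (ix u) (iy u)) c := by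
    intro u hu h1 h2 c hc h
    rw [hG _ (hrep u hu).1 c hc, Finset.mem_image]
    exact ⟨(ix u, iy u, c), Finset.mem_filter.2 ⟨hmem u h1 h2 c hc, (hrep u hu).1, h⟩, rfl⟩
  have hX : ∀ u < n, ∀ c < k, Guess k C n E₀ u c ∨ Guess k C n F₀ u c → c = f u := by
    rintro u hu c hc (h | h)
    · exact ((hE' u hu c hc).1 h).2
    · exact ((hF' u hu c hc).1 h).2
  have hfree : ∀ u < n, Piece I (Guess k C n E₀) v u →
      (¬ ∃ c < k, Guess k C n E₀ u c ∨ Guess k C n F₀ u c) →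
      (blockX u = blockX v ∧ blockY u = blockY v) ∧ ColourAdj H (f u) (f u) := by
    intro u hu hp hno
    have hfu := (hf.1 u hu).1
    have h1 : blockX u = blockX v ∧ blockY u = blockY v := (hpiece u hu hp).resolve_left fun hS =>
      hno ⟨f u, hfu, Or.inl ((hE' u hu _ hfu).2 ⟨hS, rfl⟩)⟩
    refine ⟨h1, ?_⟩
    by_contra hloop
    exact hno ⟨f u, hfu, Or.inr ((hF' u hu _ hfu).2 ⟨⟨h1, hloop⟩, rfl⟩)⟩
  refine ⟨F₀, hF₀, G₀, hG₀, ⟨fun u hu c hc c' hc' h h' => ?_,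
    fun u hu hp c₁ h₁ c₂ h₂ c₃ h₃ ha₁ ha₂ ha₃ => ?_⟩, f, fun u hu hp =>
    ⟨(hf.1 u hu).1, ⟨(hf.1 u hu).2, ?_⟩, fun u' hu' _ => ⟨fun h => by rw [h], hf.2 u hu u' hu'⟩⟩⟩
  · rw [hX u hu c hc h, hX u hu c' hc' h']
  · by_cases hdu : ∃ c < k, Guess k C n E₀ u c ∨ Guess k C n F₀ u c
    · left
      rw [hX u hu c₁ h₁ (ha₁.2.resolve_right fun h => h.1 hdu),
        hX u hu c₂ h₂ (ha₂.2.resolve_right fun h => h.1 hdu)]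
    · obtain ⟨hbl, hloop⟩ := hfree u hu hp hdu
      obtain ⟨hr1, hr2, hr3⟩ := hrep u hu
      have hcl : Close I u (rep (ix u) (iy u)) := hcell u hu _ hr1 hr2.symm hr3.symm
      have hgu := hG2 u hu hbl.1 hbl.2 (f u) (hf.1 u hu).1 ⟨hloop, u, hu, hcl, rfl⟩
      -- The object `u` is close to the representative of its own cell, which is tagged at least
      -- with `f u`; so every allowed colour of `u` is a tag of this representative, and there are
      -- at most two.
      have ht : ∀ c < k, Allowed I (Guess k C n E₀) (Guess k C n F₀) (Guess k C n G₀) u c →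
          tag (rep (ix u) (iy u)) c := fun c hc hc' =>
        (hG1 _ hr1 c hc ((hc'.2.resolve_left fun h => hdu ⟨c, hc, h⟩).2 _ hr1 (f u)
          (hf.1 u hu).1 hcl hgu)).1
      have t₁ := ht c₁ h₁ ha₁
      have t₂ := ht c₂ h₂ ha₂
      have t₃ := ht c₃ h₃ ha₃
      exact eq_of_mrc_le_two hH t₁.1 t₂.1 t₃.1 (htag _ hr1 _ _ t₁ t₂) (htag _ hr1 _ _ t₂ t₃)
        (htag _ hr1 _ _ t₁ t₃)
  · by_cases hdu : ∃ c < k, Guess k C n E₀ u c ∨ Guess k C n F₀ u c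
    · left
      obtain ⟨c, hc, h⟩ := hdu
      rwa [← hX u hu c hc h]
    · refine Or.inr ⟨hdu, fun w hw c hc hcl hg => (hG1 w hw c hc hg).2 _ (hf.1 u hu).1
        ⟨(hfree u hu hp hdu).2, u, hu, hcl, rfl⟩⟩

end

variable {k n : ℕ} {I : Input k n}

/-! ### Geometry of fat similarly-sized objects -/

theorem outRadius_nonneg (s : Set Plane) : 0 ≤ outRadius s :=
  Real.sInf_nonneg fun _ h => h.1

theorem exists_subset_closedBall_of_outRadius_pos {s : Set Plane} (h : 0 < outRadius s) :
    {r : ℝ | 0 ≤ r ∧ ∃ c : Plane, s ⊆ Metric.closedBall c r}.Nonempty := by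
  by_contra hcon
  rw [Set.not_nonempty_iff_eq_empty] at hcon
  rw [outRadius, hcon, Real.sInf_empty] at h
  exact lt_irrefl _ h

theorem isBounded_of_outRadius_pos {s : Set Plane} (h : 0 < outRadius s) :
    Bornology.IsBounded s := by
  obtain ⟨r, -, c, hc⟩ := exists_subset_closedBall_of_outRadius_pos h
  exact Metric.isBounded_closedBall.subset hc

theorem diam_le_two_mul_outRadius {s : Set Plane} (h : 0 < outRadius s) :
    Metric.diam s ≤ 2 * outRadius s := by
  have : Metric.diam s / 2 ≤ outRadius s :=
    le_csInf (exists_subset_closedBall_of_outRadius_pos h) fun r hr => by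
      obtain ⟨h0, c, hc⟩ := hr
      have := Metric.diam_le_of_subset_closedBall h0 hc
      linarith
  linarith

theorem inRadius_outRadius_pos {ι : Type*} {α : ℝ} (hα : 0 < α) {obj : ι → Set Plane}
    (h : Fat α obj) (i : ι) : 0 < inRadius (obj i) ∧ 0 < outRadius (obj i) := by
  have h1 : 0 < inRadius (obj i) / outRadius (obj i) := hα.trans_le (h i)
  have h2 : 0 < outRadius (obj i) := (outRadius_nonneg _).lt_of_ne' fun h0 => by
    simp [h0] at h1
  exact ⟨(div_pos_iff_of_pos_right h2).1 h1, h2⟩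

/-- The ball is open, so a point at distance `r / 2` from the centre is used; this suffices to show
that diameters are positive. -/
theorem radius_le_two_mul_diam {s : Set Plane} (hs : Bornology.IsBounded s) {c : Plane} {r : ℝ}
    (hr : 0 < r) (h : Metric.ball c r ⊆ s) : r ≤ 2 * Metric.diam s := by
  have h1 : dist (c + EuclideanSpace.single 0 (r / 2)) c = r / 2 := by
    rw [dist_self_add_left, PiLp.norm_single, Real.norm_of_nonneg (by positivity)]
  have h2 := Metric.dist_le_diam_of_mem hs (h (Metric.mem_ball.2 (h1 ▸ (by linarith : r / 2 < r))))
    (h (Metric.mem_ball_self hr))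
  linarith

theorem radius_pos {α γ : ℝ} (hα : 0 < α) (hγ : 0 < γ) (hfat : Fat α I.obj)
    (hdisk : I.InscribedDisks γ) (i : Fin n) : 0 < I.radius i :=
  (mul_pos hγ (inRadius_outRadius_pos hα hfat i).1).trans_le (hdisk i).2

/-- The diameter of an object is bounded in terms of the radius of any disk. -/
theorem diam_le {α β γ : ℝ} (hα : 0 < α) (hβ : 0 < β) (hγ : 0 < γ) (hfat : Fat α I.obj)
    (hsize : SimilarlySized β I.obj) (hdisk : I.InscribedDisks γ) (i j : Fin n) :
    Metric.diam (I.obj i) ≤ 2 * β / (α * γ) * I.radius j := by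
  obtain ⟨h1, h2⟩ := inRadius_outRadius_pos hα hfat j
  have hr := radius_pos hα hγ hfat hdisk j
  -- With diameter `0` the quotient in `SimilarlySized` would have the default value `0` and carry
  -- no information.
  have h3 : 0 < Metric.diam (I.obj j) := by
    linarith [radius_le_two_mul_diam (isBounded_of_outRadius_pos h2) hr (hdisk j).1]
  have h4 := (div_le_iff₀ h3).1 (hsize i j)
  have h5 := diam_le_two_mul_outRadius h2
  have h6 := (le_div_iff₀ h2).1 (hfat j)
  have h7 : α * γ * Metric.diam (I.obj j) ≤ 2 * I.radius j := by
    calc α * γ * Metric.diam (I.obj j) ≤ α * γ * (2 * outRadius (I.obj j)) := by gcongr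
      _ = 2 * (γ * (α * outRadius (I.obj j))) := by ring
      _ ≤ 2 * (γ * inRadius (I.obj j)) := by gcongr
      _ ≤ _ := by linarith [(hdisk j).2]
  rw [div_mul_eq_mul_div, le_div_iff₀ (by positivity)]
  calc Metric.diam (I.obj i) * (α * γ) ≤ β * Metric.diam (I.obj j) * (α * γ) := by gcongr
    _ = β * (α * γ * Metric.diam (I.obj j)) := by ring
    _ ≤ β * (2 * I.radius j) := by gcongr
    _ = _ := by ring

theorem abs_coord_sub_le_dist (x y : Plane) (i : Fin 2) : |x i - y i| ≤ dist x y := by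
  rw [dist_eq_norm, ← Real.norm_eq_abs]
  exact PiLp.norm_apply_le (x - y) i

/-- Both coordinates of the centres differ by less than half of the radius of `u`, so their distance
is less than the radius divided by the square root of two. -/
theorem center_mem_of_close {γ : ℝ} (hr : ∀ i, 0 < I.radius i) (hdisk : I.InscribedDisks γ)
    {u w : ℕ} (hu : u < n) (hw : w < n) (h : Close I u w) :
    I.center ⟨w, hw⟩ ∈ I.obj ⟨u, hu⟩ := by
  refine (hdisk ⟨u, hu⟩).1 ?_
  have hr := hr ⟨u, hu⟩
  simp only [Close, cx, cy, rad, dif_pos hu, dif_pos hw] at h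
  obtain ⟨h1, h2, h3, h4⟩ := h
  rw [Metric.mem_ball, EuclideanSpace.dist_eq, Fin.sum_univ_two, Real.sqrt_lt' hr,
    Real.dist_eq, Real.dist_eq, sq_abs, sq_abs]
  nlinarith

theorem meets_of_close {γ : ℝ} (hr : ∀ i, 0 < I.radius i) (hdisk : I.InscribedDisks γ)
    {u v w : ℕ} (hu : u < n) (hv : v < n) (hw : w < n) (h : Close I u w) (h' : Close I v w) :
    Meets I u v :=
  ⟨hu, hv, I.center ⟨w, hw⟩, center_mem_of_close hr hdisk hu hw h,
    center_mem_of_close hr hdisk hv hw h'⟩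

theorem abs_floor_sub_floor_le {x y K : ℝ} (h : |x - y| ≤ K) :
    |⌊x⌋ - ⌊y⌋| ≤ ((⌈K⌉₊ + 1 : ℕ) : ℤ) := by
  have h1 := Nat.le_ceil K
  have hx := Int.floor_le x
  have hx' := Int.lt_floor_add_one x
  have hy := Int.floor_le y
  have hy' := Int.lt_floor_add_one y
  rw [abs_le] at h
  have : |(⌊x⌋ : ℝ) - ⌊y⌋| ≤ ((⌈K⌉₊ + 1 : ℕ) : ℝ) := by
    push_cast
    rw [abs_le]
    constructor <;> linarith
  exact_mod_cast this

/-- The objects can be assigned to the cells of a grid. -/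
theorem exists_cells {α β γ : ℝ} (hα : 0 < α) (hβ : 0 < β) (hγ : 0 < γ) (hfat : Fat α I.obj)
    (hsize : SimilarlySized β I.obj) (hdisk : I.InscribedDisks γ) : ∃ ix iy : ℕ → ℤ,
    (∀ u < n, ∀ w < n, ix u = ix w → iy u = iy w → Close I u w) ∧
    (∀ u w, Meets I u w → |ix u - ix w| ≤ ((⌈8 * β / (α * γ)⌉₊ + 1 : ℕ) : ℤ)) ∧
    ∀ u w, Meets I u w → |iy u - iy w| ≤ ((⌈8 * β / (α * γ)⌉₊ + 1 : ℕ) : ℤ) := by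
  rcases n.eq_zero_or_pos with rfl | hn
  · refine ⟨fun _ => 0, fun _ => 0, by simp, ?_, ?_⟩ <;>
      exact fun u w _ => by simp; positivity
  have : Nonempty (Fin n) := ⟨⟨0, hn⟩⟩
  -- With the least radius as the scale, sharing a cell of side `ρ / 2` implies closeness whatever
  -- the radii of the objects are.
  obtain ⟨i₀, hi₀⟩ := Finite.exists_min I.radius
  have hr := radius_pos hα hγ hfat hdisk
  set ρ := I.radius i₀
  have hρ : 0 < ρ := hr i₀
  have hlt : ∀ x y r : ℝ, ρ ≤ r → ⌊2 * x / ρ⌋ = ⌊2 * y / ρ⌋ →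
      x + x < y + y + r ∧ y + y < x + x + r := by
    intro x y r hρr h
    have := Int.abs_sub_lt_one_of_floor_eq_floor h
    rw [← sub_div, abs_div, abs_of_pos hρ, div_lt_one hρ, abs_lt] at this
    constructor <;> linarith [this.1, this.2]
  have hdist : ∀ u w (hu : u < n) (hw : w < n), Meets I u w →
      dist (I.center ⟨u, hu⟩) (I.center ⟨w, hw⟩) ≤ 4 * β / (α * γ) * ρ := by
    rintro u w hu hw ⟨_, _, q, hqu, hqw⟩
    have hb : ∀ i, Bornology.IsBounded (I.obj i) := fun i =>
      isBounded_of_outRadius_pos (inRadius_outRadius_pos hα hfat i).2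
    have hc : ∀ i, I.center i ∈ I.obj i := fun i => (hdisk i).1 (Metric.mem_ball_self (hr i))
    have h1 := Metric.dist_le_diam_of_mem (hb _) (hc ⟨u, hu⟩) hqu
    have h2 := Metric.dist_le_diam_of_mem (hb _) hqw (hc ⟨w, hw⟩)
    have h3 := diam_le hα hβ hγ hfat hsize hdisk ⟨u, hu⟩ i₀
    have h4 := diam_le hα hβ hγ hfat hsize hdisk ⟨w, hw⟩ i₀
    have h5 : 4 * β / (α * γ) * ρ = 2 * β / (α * γ) * ρ + 2 * β / (α * γ) * ρ := by ring
    rw [h5]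
    exact (dist_triangle _ q _).trans (add_le_add (h1.trans h3) (h2.trans h4))
  -- Dividing by the cell side `ρ / 2` turns `4 * β / (α * γ) * ρ` into `8 * β / (α * γ)`; rounding
  -- both coordinates down costs one more.
  have hfloor : ∀ x y : ℝ, |x - y| ≤ 4 * β / (α * γ) * ρ →
      |⌊2 * x / ρ⌋ - ⌊2 * y / ρ⌋| ≤ ((⌈8 * β / (α * γ)⌉₊ + 1 : ℕ) : ℤ) := by
    intro x y h
    refine abs_floor_sub_floor_le ?_
    rw [← sub_div, ← mul_sub, abs_div, abs_mul, abs_of_pos hρ, div_le_iff₀ hρ, abs_two]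
    calc 2 * |x - y| ≤ 2 * (4 * β / (α * γ) * ρ) := by gcongr
      _ = _ := by ring
  refine ⟨fun u => ⌊2 * cx I u / ρ⌋, fun u => ⌊2 * cy I u / ρ⌋, fun u hu w hw hx hy => ?_,
    fun u w h => hfloor _ _ ?_, fun u w h => hfloor _ _ ?_⟩
  · have hru : ρ ≤ rad I u := by rw [rad, dif_pos hu]; exact hi₀ _
    obtain ⟨h1, h2⟩ := hlt _ _ _ hru hx
    obtain ⟨h3, h4⟩ := hlt _ _ _ hru hy
    exact ⟨h1, h2, h3, h4⟩
  all_goals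
    obtain ⟨hu, hw, -⟩ := id h
    simp only [cx, cy, dif_pos hu, dif_pos hw]
    exact (abs_coord_sub_le_dist _ _ _).trans (hdist u w hu hw h)

/-! ### The time bound -/

/-- Rounding up adds less than `1`, which is at most the real cube root itself. -/
theorem cubeRoot_le_two_mul_rpow {n : ℕ} (hn : 1 ≤ n) :
    (cubeRoot n : ℝ) ≤ 2 * (n : ℝ) ^ ((1 : ℝ) / 3) := by
  have hn' : (1 : ℝ) ≤ n := by exact_mod_cast hn
  have h1 : (1 : ℝ) ≤ (n : ℝ) ^ ((1 : ℝ) / 3) := Real.one_le_rpow hn' (by norm_num)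
  have h2 : n ≤ ⌈(n : ℝ) ^ ((1 : ℝ) / 3)⌉₊ ^ 3 := by
    have h3 : (n : ℝ) = ((n : ℝ) ^ ((1 : ℝ) / 3)) ^ 3 := by
      rw [← Real.rpow_natCast, ← Real.rpow_mul (by positivity)]
      norm_num
    have h4 : (n : ℝ) ≤ (⌈(n : ℝ) ^ ((1 : ℝ) / 3)⌉₊ : ℝ) ^ 3 := by
      conv_lhs => rw [h3]
      gcongr
      exact Nat.le_ceil _
    exact_mod_cast h4
  have h5 : (cubeRoot n : ℝ) ≤ ⌈(n : ℝ) ^ ((1 : ℝ) / 3)⌉₊ := by exact_mod_cast cubeRoot_le h2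
  have h6 := Nat.ceil_lt_add_one (a := (n : ℝ) ^ ((1 : ℝ) / 3)) (by positivity)
  linarith

theorem Subexp.exists_bound {t : ℕ → ℕ} (ht : Subexp t) : ∃ C : ℕ, ∀ n : ℕ,
    (t n : ℝ) ≤ (C : ℝ) * 2 ^ ((C : ℝ) * (n : ℝ) ^ ((2 : ℝ) / 3) * Real.logb 2 n) := by
  obtain ⟨c, hc⟩ := ht
  -- For `n = 0` and `n = 1` the logarithm is `0`, so `C` itself has to bound `t 0` and `t 1`. For
  -- `n ≥ 2`, `n + 2 ≤ n ^ 2` doubles the exponent, and `cubeRoot n ^ 2 + 1` is at most five times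
  -- `n ^ (2 / 3)`; this gives `10 * c`. The final `1` makes the factor `C` at least one.
  refine ⟨t 0 + t 1 + 10 * c + 1, fun n => ?_⟩
  obtain rfl | rfl | hn : n = 0 ∨ n = 1 ∨ 2 ≤ n := by omega
  · simp only [CharP.cast_eq_zero, Real.logb_zero, mul_zero, Real.rpow_zero, mul_one]
    exact_mod_cast (by omega)
  · simp only [Nat.cast_one, Real.logb_one, mul_zero, Real.rpow_zero, mul_one]
    exact_mod_cast (by omega)
  have hn' : (2 : ℝ) ≤ n := by exact_mod_cast hn
  have h0 : (0 : ℝ) < n := by linarith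
  have hx : (1 : ℝ) ≤ (n : ℝ) ^ ((2 : ℝ) / 3) := Real.one_le_rpow (by linarith) (by norm_num)
  have hsq : (cubeRoot n : ℝ) ^ 2 ≤ 4 * (n : ℝ) ^ ((2 : ℝ) / 3) := by
    calc (cubeRoot n : ℝ) ^ 2 ≤ (2 * (n : ℝ) ^ ((1 : ℝ) / 3)) ^ 2 := by
          gcongr
          exact cubeRoot_le_two_mul_rpow (by omega)
      _ = 4 * ((n : ℝ) ^ ((1 : ℝ) / 3)) ^ 2 := by ring
      _ = _ := by
          rw [← Real.rpow_natCast ((n : ℝ) ^ ((1 : ℝ) / 3)), ← Real.rpow_mul h0.le]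
          norm_num
  set C : ℕ := t 0 + t 1 + 10 * c + 1 with hC
  have hC1 : (1 : ℝ) ≤ C := by exact_mod_cast (by omega : 1 ≤ C)
  have hCc : 10 * (c : ℝ) ≤ C := by exact_mod_cast (by omega : 10 * c ≤ C)
  calc (t n : ℝ) ≤ ((n + 2 : ℕ) : ℝ) ^ (c * (cubeRoot n ^ 2 + 1)) := by exact_mod_cast hc n
    _ ≤ ((n : ℝ) ^ 2) ^ (c * (cubeRoot n ^ 2 + 1)) := by
        gcongr
        push_cast
        nlinarith
    _ = (n : ℝ) ^ ((2 * (c * (cubeRoot n ^ 2 + 1)) : ℕ) : ℝ) := by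
        rw [← pow_mul, Real.rpow_natCast]
    _ ≤ (n : ℝ) ^ ((C : ℝ) * (n : ℝ) ^ ((2 : ℝ) / 3)) := by
        refine Real.rpow_le_rpow_of_exponent_le (by linarith) ?_
        push_cast
        calc 2 * ((c : ℝ) * ((cubeRoot n : ℝ) ^ 2 + 1))
            ≤ 2 * ((c : ℝ) * (5 * (n : ℝ) ^ ((2 : ℝ) / 3))) := by gcongr; linarith
          _ = 10 * (c : ℝ) * (n : ℝ) ^ ((2 : ℝ) / 3) := by ring
          _ ≤ _ := by gcongr
    _ = 2 ^ ((C : ℝ) * (n : ℝ) ^ ((2 : ℝ) / 3) * Real.logb 2 n) := by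
        rw [mul_comm _ (Real.logb 2 n), Real.rpow_mul zero_le_two,
          Real.rpow_logb zero_lt_two (by norm_num) h0]
    _ ≤ _ := le_mul_of_one_le_left (by positivity) hC1

end FatLHom

end

theorem theorem3 {k : ℕ} (H : FatLHom.LoopGraph (Fin k)) (hH : H.mrc ≤ 2)
    (α β γ : ℝ) (hα : 0 < α) (hβ : 0 < β) (hγ : 0 < γ) :
    ∃ (P : FatLHom.Prog) (C : ℕ), ∀ (n : ℕ) (I : FatLHom.Input k n),
      FatLHom.Fat α I.obj → FatLHom.SimilarlySized β I.obj → I.InscribedDisks γ →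
      P.Solves H I ((C : ℝ) * 2 ^ ((C : ℝ) * (n : ℝ) ^ ((2 : ℝ) / 3) * Real.logb 2 n)) := by
  -- The number of slots per `m ^ 2` is `2 + D ^ 2 * k` with `D = ⌈8 * β / (α * γ)⌉₊ + 1`: two units
  -- for the separator, and `D ^ 2 * k` for the pairs of a cell of a block and a colour.
  obtain ⟨P, t, ht, hP⟩ := FatLHom.exists_program H
    (2 + (⌈8 * β / (α * γ)⌉₊ + 1) ^ 2 * k)
  obtain ⟨C, hC⟩ := ht.exists_bound
  refine ⟨P, C, fun n I hfat hsize hdisk => ?_⟩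
  obtain ⟨out, τ, h1, h2, h3⟩ := hP n I
  refine ⟨out, τ, h1, le_trans (by exact_mod_cast h2) (hC n), ?_⟩
  obtain ⟨ix, iy, hcell, hix, hiy⟩ := FatLHom.exists_cells hα hβ hγ hfat hsize hdisk
  have hr := FatLHom.radius_pos hα hγ hfat hdisk
  have hiff : FatLHom.Accepts H (2 + (⌈8 * β / (α * γ)⌉₊ + 1) ^ 2 * k) I ↔ I.IsYes H := by
    rw [FatLHom.isYes_iff]
    refine ⟨FatLHom.exists_colouring_of_accepts, ?_⟩
    rintro ⟨f, hf⟩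
    exact FatLHom.accepts_of_colouring hH (Nat.succ_pos _) ix iy hcell hix hiy
      (fun u hu v hv w hw h h' => FatLHom.meets_of_close hr hdisk hu hv hw h h') hf
  rw [h3, hiff]
  rfl
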